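/- Let $F,G$ be probability measures on $\mathbb{R}^d$ and let $x_1,x_2,\dots\sim F$ and $y_1,y_2,\dots\sim G$ be independent observations, with empirical distributions $F_m$ of $x_1,\dots,x_m$ and $G_n$ of $y_1,\dots,y_n$. Let $D(\cdot\,;\cdot)$ be a depth function, assigning to each point $x\in\mathbb{R}^d$ and each distribution $H$ a value $D(x;H)\in[0,1]$ (with the usual measurability), and put $$R(y;F)=\int 1_{\{D(x;F)\le D(y;F)\}}\,dF(x),\qquad \mathcal{Q}(F,G)=\int R(y;F)\,dG(y).$$ Let $X,X_1,X_2,\dots$ be i.i.d. with law $F$; in (A2)–(A4), $F_m$ denotes the empirical distribution of $X_1,\dots,X_m$ and $F_m^{-\{1\}}$ that of $X_2,\dots,X_m$. Assume that for some $\tfrac12<\beta\le 1$: (A1) there is $C>0$ with $\mathbb{P}(D(X;F)\in[y_1,y_2])\le C|y_2-y_1|^{\beta}$ for all $y_1,y_2\ge 0$; (A2) $\mathbb{E}\big(\sup_{x\in\mathbb{R}^d}|D(x;F_m)-D(x;F)|^{2\beta}\big)=O(m^{-\beta})$; (A3) there are a deterministic constant $C_{\mathrm{det}}$ and an $m_0$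 such that for every $m\ge m_0$, almost surely, $\sup_{x\in\mathbb{R}^d}|D(x;F_m)-D(x;F_m^{-\{1\}})|\le C_{\mathrm{det}}/m$; (A4) for every constant $C>0$, $\mathbb{E}\Big(\big[\mathbb{P}\big(|D(X_1;F_m^{-\{1\}})-D(X;F_m^{-\{1\}})|\le C/m \,\big|\, X_2,\dots,X_m\big)\big]^2\Big)=O(m^{-2\beta})$. For $\lambda>0$ and $\theta\in\mathbb{R}$ define $$\mathcal{R}(\lambda,\theta,F_m,G_n)=\frac{12mn}{m+n}\,\vec{\mathcal{Q}}^{T}\begin{pmatrix}\cos^2\theta+\lambda\sin^2\theta&(1-\lambda)\sin\theta\cos\theta\\(1-\lambda)\sin\theta\cos\theta&\sin^2\theta+\lambda\cos^2\theta\end{pmatrix}\vec{\mathcal{Q}},\qquad \vec{\mathcal{Q}}=\begin{pmatrix}\mathcal{Q}(F_m,G_n)-\frac12\\ \mathcal{Q}(G_n,F_m)-\frac12\end{pmatrix},$$ and $\mathcal{E}_{m,n}(\lambda)=\mathcal{R}(\lambda,\tfrac{\pi}{4},F_m,G_n)$. If $m,n\to\infty$ with $\frac{m}{m+n}\to\tau$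 for some $0<\tau<1$, then under the null hypothesis $H_0:F=G$, $$\mathcal{R}(\lambda,\theta,F_m,G_n)\xrightarrow{\;d\;}\big[1+\lambda-(1-\lambda)\sin 2\theta\big]\chi^2_1 .$$ In particular $\frac{1}{2\lambda}\mathcal{E}_{m,n}(\lambda)\xrightarrow{\;d\;}\chi^2_1$. -/

import Mathlib

open MeasureTheory ProbabilityTheory Filter Topology
open scoped ENNReal NNReal Matrix

noncomputable section

/-- The empirical measure `(1/m) ∑ᵢ δ_{xᵢ}` of a finite sample `x₁, …, x_m`. -/
def empiricalMeasure {E : Type*} [MeasurableSpace E] {m : ℕ} (x : Fin m → E) : Measure E :=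
  (m : ℝ≥0∞)⁻¹ • ∑ i, Measure.dirac (x i)

/-- `R(y; F) = ∫ 1{D(x; F) ≤ D(y; F)} dF(x)`, the relative deepness of `y` with respect to `F`. -/
def relativeDeepness {E : Type*} [MeasurableSpace E] (D : E → Measure E → ℝ)
    (F : Measure E) (y : E) : ℝ :=
  F.real {x | D x F ≤ D y F}

/-- `Q(F, G) = ∫ R(y; F) dG(y)`, the Liu–Singh quality index with reference distribution `F`. -/
def qualityIndex {E : Type*} [MeasurableSpace E] (D : E → Measure E → ℝ)
    (F G : Measure E) : ℝ :=
  ∫ y, relativeDeepness D F y ∂G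

/-- The quality index of two empirical measures is the usual double sample average. -/
theorem qualityIndex_empirical {E : Type*} [MeasurableSpace E] [MeasurableSingletonClass E]
    (D : E → Measure E → ℝ) {m n : ℕ} (x : Fin m → E) (y : Fin n → E) :
    qualityIndex D (empiricalMeasure x) (empiricalMeasure y) =
      (n : ℝ)⁻¹ * ∑ j, (m : ℝ)⁻¹ * ∑ i,
        Set.indicator {z | D z (empiricalMeasure x) ≤ D (y j) (empiricalMeasure x)}
          (fun _ => (1 : ℝ)) (x i) := by
  have key : ∀ y' : E, relativeDeepness D (empiricalMeasure x) y' = (m : ℝ)⁻¹ * ∑ i,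
      Set.indicator {z | D z (empiricalMeasure x) ≤ D y' (empiricalMeasure x)}
        (fun _ => (1 : ℝ)) (x i) := by
    intro y'
    unfold relativeDeepness
    generalize {z | D z (empiricalMeasure x) ≤ D y' (empiricalMeasure x)} = S
    simp only [empiricalMeasure, Measure.real, Measure.smul_apply, Measure.finsetSum_apply,
      Measure.dirac_apply, smul_eq_mul, ENNReal.toReal_mul, ENNReal.toReal_inv,
      ENNReal.toReal_natCast]
    congr 1
    rw [ENNReal.toReal_sum]
    · refine Finset.sum_congr rfl fun i _ => ?_
      by_cases h : x i ∈ S <;> simp [h]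
    · intro i _
      by_cases h : x i ∈ S <;> simp [h]
  unfold qualityIndex
  conv_lhs => rw [show empiricalMeasure y = (n : ℝ≥0∞)⁻¹ • ∑ j, Measure.dirac (y j) from rfl]
  rw [integral_smul_measure, integral_finsetSum_measure]
  · simp [key]
  · intro j _
    exact integrable_dirac (by simp)

/-- Condition A1: `P(D(X, F) ∈ [y₁, y₂]) ≤ C |y₂ - y₁|^β` for `X ∼ F`. -/
def CondA1 {E : Type*} [MeasurableSpace E] (D : E → Measure E → ℝ) (F : Measure E) (β : ℝ) :
    Prop :=
  ∃ C : ℝ, 0 < C ∧ ∀ y₁ y₂ : ℝ, 0 ≤ y₁ → 0 ≤ y₂ →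
    F.real {x | D x F ∈ Set.Icc y₁ y₂} ≤ C * |y₂ - y₁| ^ β

/-- Condition A2: `E (sup_z |D(z, F_m) - D(z, F)|^{2β}) = O(m^{-β})` for an i.i.d. sample of size
`m` from `F`. -/
def CondA2 {E : Type*} [MeasurableSpace E] (D : E → Measure E → ℝ) (F : Measure E) (β : ℝ) :
    Prop :=
  ∃ (K : ℝ) (m₀ : ℕ), ∀ m : ℕ, m₀ ≤ m →
    ∫⁻ x, (⨆ z, ENNReal.ofReal |D z (empiricalMeasure x) - D z F|) ^ (2 * β)
        ∂(Measure.pi fun _ : Fin m => F)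
      ≤ ENNReal.ofReal (K * (m : ℝ) ^ (-β))

/-- Condition A3: almost surely `sup_z |D(z, F_m) - D(z, F_m^{-{1}})| ≤ C/m`, for all large sample
sizes `m = k + 1`; `Fin.tail x` is the sample `x` without its first observation. -/
def CondA3 {E : Type*} [MeasurableSpace E] (D : E → Measure E → ℝ) (F : Measure E) : Prop :=
  ∃ (C : ℝ) (m₀ : ℕ), ∀ k : ℕ, m₀ ≤ k + 1 →
    ∀ᵐ x ∂(Measure.pi fun _ : Fin (k + 1) => F), ∀ z : E,
      |D z (empiricalMeasure x) - D z (empiricalMeasure (Fin.tail x))| ≤ C / ((k + 1 : ℕ) : ℝ)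

/-- Condition A4: for every `C > 0`,
`E ([P(|D(X₁, F_m^{-{1}}) - D(X, F_m^{-{1}})| ≤ C/m | X₂, …, X_m)]²) = O(m^{-2β})`, where
`X, X₁, …, X_m` are i.i.d. from `F` and `m = k + 1`. By independence, the conditional probability
given `(X₂, …, X_m) = x` is a probability under the law `F × F` of `(X₁, X)`. -/
def CondA4 {E : Type*} [MeasurableSpace E] (D : E → Measure E → ℝ) (F : Measure E) (β : ℝ) :
    Prop :=
  ∀ C : ℝ, 0 < C → ∃ (K : ℝ) (m₀ : ℕ), ∀ k : ℕ, m₀ ≤ k + 1 →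
    ∫⁻ x, ((F.prod F) {p | |D p.1 (empiricalMeasure x) - D p.2 (empiricalMeasure x)|
          ≤ C / ((k + 1 : ℕ) : ℝ)}) ^ 2
        ∂(Measure.pi fun _ : Fin k => F)
      ≤ ENNReal.ofReal (K * ((k + 1 : ℕ) : ℝ) ^ (-(2 * β)))

/-- The matrix of the quadratic form of the rotated ellipse with rotation angle `θ` and axis
ratio `lam`. -/
def ellipseMatrix (lam θ : ℝ) : Matrix (Fin 2) (Fin 2) ℝ :=
  !![Real.cos θ ^ 2 + lam * Real.sin θ ^ 2, (1 - lam) * Real.sin θ * Real.cos θ;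
     (1 - lam) * Real.sin θ * Real.cos θ, Real.sin θ ^ 2 + lam * Real.cos θ ^ 2]

/-- The centred pair of quality indices `(Q(F, G) - 1/2, Q(G, F) - 1/2)`. -/
def centredQuality {E : Type*} [MeasurableSpace E] (D : E → Measure E → ℝ)
    (F G : Measure E) : Fin 2 → ℝ :=
  ![qualityIndex D F G - 1 / 2, qualityIndex D G F - 1 / 2]

/-- The rotated-ellipse statistic `R(lam, θ, F_m, G_n)` of the samples `x₁, …, x_m` and
`y₁, …, y_n`. -/
def ellipseStatistic {E : Type*} [MeasurableSpace E] (D : E → Measure E → ℝ) (lam θ : ℝ)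
    {m n : ℕ} (x : Fin m → E) (y : Fin n → E) : ℝ :=
  12 * (m : ℝ) * (n : ℝ) / ((m : ℝ) + (n : ℝ)) *
    (centredQuality D (empiricalMeasure x) (empiricalMeasure y) ⬝ᵥ
      (ellipseMatrix lam θ *ᵥ centredQuality D (empiricalMeasure x) (empiricalMeasure y)))

/-- The ellipse statistic `E_{m,n}(lam)`, which is the rotated-ellipse statistic with rotation
angle `π/4`. -/
def ellipseStatisticE {E : Type*} [MeasurableSpace E] (D : E → Measure E → ℝ) (lam : ℝ)
    {m n : ℕ} (x : Fin m → E) (y : Fin n → E) : ℝ :=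
  ellipseStatistic D lam (Real.pi / 4) x y

/-- The chi-squared distribution with one degree of freedom: the law of the square of a standard
normal random variable. -/
def chiSquaredOne : Measure ℝ := (gaussianReal 0 1).map fun z => z ^ 2

instance : IsProbabilityMeasure chiSquaredOne :=
  Measure.isProbabilityMeasure_map (by fun_prop)

end

/-!
Under the null hypothesis both samples come from one law `F`, so the whole configuration is a family
of i.i.d. observations, and every expectation may be computed after permuting them.

Write `κ(a, b) = ±1/2` according to whether `a < b` or `b < a`, and `0` for a tie. Up to ties,
`Q(F_m, G_n) - 1/2` is the average over pairs `(i, j)` of `κ(D(x_i; F_m), D(y_j; F_m))`. The point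
is that it has the same linear part as if the population depth were used,

  `Q(F_m, G_n) - 1/2 = n⁻¹ ∑ r(y_j) - m⁻¹ ∑ r(x_i) + o_P(m^{-1/2})`, `r(y) = ∫ κ(D(x; F), D(y; F)) dF(x)`.

The proof has three steps.

* The sample depth is replaced by its leave-one-out version at `x_i`. By A3 this changes a comparison
  only at a near tie of width `O(1/m)`, and by A4 such ties have probability `O(m^{-β})`, which is
  `o(m^{-1/2})` (`integral_abs_avg_indicator_sub_le`).
* The leave-one-out comparison is replaced by the population comparison, in `L²`. The diagonal terms
  are negligible since the comparisons converge in mean by A1 and A2. For an off-diagonal covariance,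
  each factor is split into a leave-two-out part and a remainder; because `κ` is antisymmetric,
  exchanging `x_i` with `y_j` kills all products but that of the two remainders, and this one lives
  on two simultaneous near ties, of probability `O(m^{-2β}) = o(m^{-1})` by A4
  (`integral_kernel_mul_le`, `integral_avg_kernel_sub_sq_le`).
* The two-sample U-statistic with kernel `κ(D(x; F), D(y; F))` is replaced by its projection
  (`integral_avg_degenerateKernel_sq_le`).

Exchanging the roles of the samples, `Q(G_n, F_m) - 1/2` has the opposite linear part. The
observations `r(x_i)` are centred with variance `1/12`, by exchangeability of three observations and
absence of ties (`integral_centredRank_sq`), so that the linear part, scaled by `√(12mn/(m+n))`, is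
asymptotically standard normal. By Slutsky's theorem the statistic converges to the square of a
standard normal variable times the value at `(1, -1)` of the quadratic form of the ellipse matrix,
which is `1 + lam - (1 - lam) sin 2θ`.
-/

/-! ### The sign kernel -/

/-- The centred comparison kernel: `1/2` if `a < b`, `-1/2` if `b < a`, and `0` for a tie. -/
noncomputable def signKernel (a b : ℝ) : ℝ :=
  if a < b then 1 / 2 else if b < a then -(1 / 2) else 0

theorem signKernel_swap (a b : ℝ) : signKernel b a = -signKernel a b := by
  unfold signKernel; split_ifs <;> linarith

theorem abs_signKernel_le (a b : ℝ) : |signKernel a b| ≤ 1 / 2 := by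
  unfold signKernel; split_ifs <;> norm_num [abs_of_pos, abs_neg]

theorem measurable_signKernel : Measurable fun p : ℝ × ℝ => signKernel p.1 p.2 := by
  unfold signKernel
  exact Measurable.ite (measurableSet_lt measurable_fst measurable_snd) measurable_const
    (Measurable.ite (measurableSet_lt measurable_snd measurable_fst) measurable_const
      measurable_const)

theorem Measurable.signKernel {α : Type*} [MeasurableSpace α] {f g : α → ℝ} (hf : Measurable f)
    (hg : Measurable g) : Measurable fun x => signKernel (f x) (g x) :=
  measurable_signKernel.comp (hf.prodMk hg)

/-- Moving both arguments by at most `δ` changes the kernel only if they are `2δ`-close. -/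
theorem abs_signKernel_sub_le {a b a' b' δ : ℝ} (ha : |a' - a| ≤ δ) (hb : |b' - b| ≤ δ) :
    |signKernel a' b' - signKernel a b| ≤ if |a - b| ≤ 2 * δ then 1 else 0 := by
  split_ifs with h
  · calc _ ≤ |signKernel a' b'| + |signKernel a b| := abs_sub _ _
      _ ≤ 1 / 2 + 1 / 2 := add_le_add (abs_signKernel_le _ _) (abs_signKernel_le _ _)
      _ = 1 := by norm_num
  · rw [abs_le] at ha hb
    rw [not_le, lt_abs] at h
    unfold signKernel
    rcases h with h | h
    · rw [if_neg (by linarith), if_pos (by linarith), if_neg (by linarith), if_pos (by linarith)]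
      simp
    · rw [if_pos (by linarith), if_pos (by linarith)]
      simp

/-- The centred indicator of `a' ≤ b'` is the kernel at any nearby pair `(a, b)` that is not
close to a tie. -/
theorem abs_indicator_sub_signKernel_le {a b a' b' δ : ℝ} (ha : |a' - a| ≤ δ)
    (hb : |b' - b| ≤ δ) :
    |((if a' ≤ b' then 1 else 0) - 1 / 2) - signKernel a b|
      ≤ if |a - b| ≤ 2 * δ then 1 else 0 := by
  rw [abs_le] at ha hb
  split_ifs with h1 h h
  · have := abs_le.1 (abs_signKernel_le a b)
    rw [abs_le]; constructor <;> linarith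
  · rw [not_le, lt_abs] at h
    unfold signKernel
    rw [if_pos (by rcases h with h | h <;> linarith)]
    norm_num
  · have := abs_le.1 (abs_signKernel_le a b)
    rw [abs_le]; constructor <;> linarith
  · rw [not_le, lt_abs] at h
    unfold signKernel
    rw [if_neg (by rcases h with h | h <;> linarith), if_pos (by rcases h with h | h <;> linarith)]
    norm_num

/-- Among three distinct reals, summing over the choice of the reference point `y` the product of
the two comparisons with `y` gives `1/4 - 1/4 + 1/4`. -/
theorem signKernel_cyclic {a b c : ℝ} (hab : a ≠ b) (hac : a ≠ c) (hbc : b ≠ c) :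
    signKernel b a * signKernel c a + signKernel a b * signKernel c b
      + signKernel a c * signKernel b c = 1 / 4 := by
  unfold signKernel
  rcases lt_or_gt_of_ne hab with h1 | h1 <;> rcases lt_or_gt_of_ne hac with h2 | h2 <;>
    rcases lt_or_gt_of_ne hbc with h3 | h3 <;>
    first
    | (exfalso; linarith)
    | (simp only [h1, h2, h3, h1.not_gt, h2.not_gt, h3.not_gt, if_true, if_false]; norm_num)

/-! ### Independent coordinates -/

section Iid

variable {E ι : Type*} [MeasurableSpace E] (F : Measure E) [IsProbabilityMeasure F]

/-- The law of a family of independent observations from `F`, indexed by `ι`. -/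
noncomputable abbrev iidMeasure (ι : Type*) : Measure (ι → E) := Measure.infinitePi fun _ : ι => F

theorem measurePreserving_reindex {α : Type*} {f : α → ι} (hf : Function.Injective f) :
    MeasurePreserving (fun (z : ι → E) a => z (f a)) (iidMeasure F ι) (iidMeasure F α) where
  measurable := by fun_prop
  map_eq := Measure.map_infinitePi_infinitePi_of_inj (P := fun _ : ι => F) hf

theorem measurePreserving_sample {k : ℕ} (e : Fin k ↪ ι) :
    MeasurePreserving (fun (z : ι → E) a => z (e a)) (iidMeasure F ι)
      (Measure.pi fun _ : Fin k => F) := by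
  rw [← Measure.infinitePi_eq_pi]
  exact measurePreserving_reindex F e.injective

theorem measurePreserving_pair {i j : ι} (hij : i ≠ j) :
    MeasurePreserving (fun z : ι → E => (z i, z j)) (iidMeasure F ι) (F.prod F) where
  measurable := by fun_prop
  map_eq := Measure.infinitePi_map_eval_prod (P := fun _ : ι => F) hij

/-- The configuration that agrees with `w` on `S` and with `z` off `S`. -/
def resample (S : ι → Prop) [DecidablePred S] (z w : ι → E) : ι → E :=
  fun a => if S a then w a else z a

/-- Replacing the coordinates in `S` by those of an independent copy does not change the law;
this is the form in which Fubini's theorem is used. -/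
theorem measurePreserving_resample (S : ι → Prop) [DecidablePred S] :
    MeasurePreserving (fun p : (ι → E) × (ι → E) => resample S p.1 p.2)
      ((iidMeasure F ι).prod (iidMeasure F ι)) (iidMeasure F ι) where
  measurable := by
    refine measurable_pi_iff.2 fun a => ?_
    unfold resample
    split_ifs <;> fun_prop
  map_eq := by
    have hmeas : Measurable fun p : (ι → E) × (ι → E) => resample S p.1 p.2 := by
      refine measurable_pi_iff.2 fun a => ?_
      unfold resample
      split_ifs <;> fun_prop
    refine Measure.eq_infinitePi _ fun s t ht => ?_
    rw [Measure.map_apply hmeas (.pi s.countable_toSet fun i _ => ht i)]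
    have : (fun p : (ι → E) × (ι → E) => resample S p.1 p.2) ⁻¹' (Set.pi s t)
        = (Set.pi (s.filter fun a => ¬ S a) t) ×ˢ (Set.pi (s.filter S) t) := by
      ext ⟨z, w⟩
      simp only [Set.mem_preimage, Set.mem_pi, Set.mem_prod, Finset.mem_coe, Finset.mem_filter,
        resample]
      constructor
      · intro h
        exact ⟨fun i hi => by simpa [hi.2] using h i hi.1,
          fun i hi => by simpa [hi.2] using h i hi.1⟩
      · rintro ⟨h1, h2⟩ i hi
        by_cases hS : S i
        · simpa [hS] using h2 i ⟨hi, hS⟩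
        · simpa [hS] using h1 i ⟨hi, hS⟩
    rw [this, Measure.prod_prod, Measure.infinitePi_pi _ fun i _ => ht i,
      Measure.infinitePi_pi _ fun i _ => ht i, mul_comm, Finset.prod_filter_mul_prod_filter_not]

theorem lintegral_iid_eq_resample (S : ι → Prop) [DecidablePred S] {f : (ι → E) → ℝ≥0∞}
    (hf : Measurable f) :
    ∫⁻ z, f z ∂iidMeasure F ι = ∫⁻ z, ∫⁻ w, f (resample S z w) ∂iidMeasure F ι ∂iidMeasure F ι := by
  have h := measurePreserving_resample F S
  rw [← h.lintegral_comp hf]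
  exact lintegral_prod _ (hf.comp h.measurable).aemeasurable

theorem integral_iid_eq_resample (S : ι → Prop) [DecidablePred S] {f : (ι → E) → ℝ}
    (hf : Measurable f) (hfi : Integrable f (iidMeasure F ι)) :
    ∫ z, f z ∂iidMeasure F ι = ∫ z, ∫ w, f (resample S z w) ∂iidMeasure F ι ∂iidMeasure F ι := by
  have h := measurePreserving_resample F S
  have hfi' : Integrable (fun p : (ι → E) × (ι → E) => f (resample S p.1 p.2))
      ((iidMeasure F ι).prod (iidMeasure F ι)) := by
    rw [← h.map_eq] at hfi
    exact hfi.comp_measurable h.measurable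
  rw [← integral_prod _ hfi']
  conv_lhs => rw [← h.map_eq]
  exact integral_map h.measurable.aemeasurable hf.aestronglyMeasurable

/-- A pair of further observations is independent of a sample. -/
theorem lintegral_pair_sample {k : ℕ} (e : Fin k ↪ ι) {i j : ι} (hij : i ≠ j)
    (hi : i ∉ Set.range e) (hj : j ∉ Set.range e) {Φ : (E × E) × (Fin k → E) → ℝ≥0∞}
    (hΦ : Measurable Φ) :
    ∫⁻ z, Φ ((z i, z j), fun a => z (e a)) ∂iidMeasure F ι
      = ∫⁻ x, ∫⁻ p, Φ (p, x) ∂(F.prod F) ∂(Measure.pi fun _ : Fin k => F) := by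
  classical
  rw [lintegral_iid_eq_resample F (fun a => a = i ∨ a = j) (by fun_prop)]
  have key : ∀ z : ι → E, ∫⁻ w, Φ ((resample (fun a => a = i ∨ a = j) z w i,
      resample (fun a => a = i ∨ a = j) z w j), fun a =>
        resample (fun a => a = i ∨ a = j) z w (e a)) ∂iidMeasure F ι
      = ∫⁻ p, Φ (p, fun a => z (e a)) ∂(F.prod F) := by
    intro z
    rw [← (measurePreserving_pair F hij).lintegral_comp (by fun_prop)]
    refine lintegral_congr fun w => ?_
    have : (fun a => resample (fun a => a = i ∨ a = j) z w (e a)) = fun a => z (e a) := by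
      funext a
      have h1 : e a ≠ i := fun h => hi ⟨a, h⟩
      have h2 : e a ≠ j := fun h => hj ⟨a, h⟩
      simp [resample, h1, h2]
    rw [this]
    simp [resample]
  simp_rw [key]
  exact (measurePreserving_sample F e).lintegral_comp
    (f := fun x => ∫⁻ p, Φ (p, x) ∂(F.prod F)) (Measurable.lintegral_prod_left hΦ)

/-- Two disjoint pairs of further observations are independent given a sample. -/
theorem lintegral_two_pairs_sample {k : ℕ} (e : Fin k ↪ ι) {i j i' j' : ι} (hij : i ≠ j)
    (hij' : i' ≠ j') (hii' : i ≠ i') (hi_j' : i ≠ j') (hj_i' : j ≠ i') (hjj' : j ≠ j')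
    (hi : i ∉ Set.range e) (hj : j ∉ Set.range e)
    (hi' : i' ∉ Set.range e) (hj' : j' ∉ Set.range e) {Φ : (E × E) × (Fin k → E) → ℝ≥0∞}
    (hΦ : Measurable Φ) :
    ∫⁻ z, Φ ((z i, z j), fun a => z (e a)) * Φ ((z i', z j'), fun a => z (e a)) ∂iidMeasure F ι
      = ∫⁻ x, (∫⁻ p, Φ (p, x) ∂(F.prod F)) ^ 2 ∂(Measure.pi fun _ : Fin k => F) := by
  classical
  rw [lintegral_iid_eq_resample F (fun a => a = i' ∨ a = j') (by fun_prop)]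
  have key : ∀ z : ι → E, ∫⁻ w, Φ ((resample (fun a => a = i' ∨ a = j') z w i,
      resample (fun a => a = i' ∨ a = j') z w j), fun a =>
        resample (fun a => a = i' ∨ a = j') z w (e a)) *
        Φ ((resample (fun a => a = i' ∨ a = j') z w i',
      resample (fun a => a = i' ∨ a = j') z w j'), fun a =>
        resample (fun a => a = i' ∨ a = j') z w (e a)) ∂iidMeasure F ι
      = Φ ((z i, z j), fun a => z (e a)) * ∫⁻ p, Φ (p, fun a => z (e a)) ∂(F.prod F) := by
    intro z
    rw [← (measurePreserving_pair F hij').lintegral_comp (by fun_prop),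
      ← lintegral_const_mul _ (by fun_prop)]
    refine lintegral_congr fun w => ?_
    have : (fun a => resample (fun a => a = i' ∨ a = j') z w (e a)) = fun a => z (e a) := by
      funext a
      have h1 : e a ≠ i' := fun h => hi' ⟨a, h⟩
      have h2 : e a ≠ j' := fun h => hj' ⟨a, h⟩
      simp [resample, h1, h2]
    rw [this]
    simp [resample, hii', hi_j', hj_i', hjj']
  simp_rw [key]
  have hm : Measurable fun x : Fin k → E => ∫⁻ p, Φ (p, x) ∂(F.prod F) :=
    Measurable.lintegral_prod_left hΦ
  rw [lintegral_pair_sample F e hij hi hj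
    (Φ := fun q => Φ q * ∫⁻ p, Φ (p, q.2) ∂(F.prod F)) (hΦ.mul (hm.comp measurable_snd))]
  refine lintegral_congr fun x => ?_
  rw [sq]
  exact lintegral_mul_const (∫⁻ p, Φ (p, x) ∂(F.prod F)) (f := fun p => Φ (p, x)) (by fun_prop)

/-- An integrand that is odd under the exchange of two observations has mean zero. -/
theorem integral_eq_zero_of_swap [DecidableEq ι] (i j : ι) {f : (ι → E) → ℝ} (hf : Measurable f)
    (h : ∀ z, f (fun a => z (Equiv.swap i j a)) = -f z) : ∫ z, f z ∂iidMeasure F ι = 0 := by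
  have hp := measurePreserving_reindex F (Equiv.swap i j).injective
  have : ∫ z, f z ∂iidMeasure F ι = -∫ z, f z ∂iidMeasure F ι := by
    conv_lhs => rw [← hp.map_eq, integral_map hp.measurable.aemeasurable hf.aestronglyMeasurable]
    rw [← integral_neg]
    exact integral_congr_ae (ae_of_all _ h)
  linarith

end Iid

/-! ### Empirical measures of subfamilies -/

section Empirical

variable {E ι : Type*} [MeasurableSpace E]

/-- The empirical measure of the observations of `z` with index in `u`. -/
noncomputable def empOn (z : ι → E) (u : Finset ι) : Measure E :=
  (u.card : ℝ≥0∞)⁻¹ • ∑ a ∈ u, Measure.dirac (z a)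

theorem empOn_map (z : ι → E) {k : ℕ} (e : Fin k ↪ ι) :
    empOn z (Finset.univ.map e) = empiricalMeasure fun a => z (e a) := by
  simp [empOn, empiricalMeasure]

theorem exists_enum (u : Finset ι) {k : ℕ} (hk : u.card = k) :
    ∃ e : Fin k ↪ ι, Finset.univ.map e = u := by
  refine ⟨(u.equivFinOfCardEq hk).symm.toEmbedding.trans (Function.Embedding.subtype _), ?_⟩
  ext a
  simp [← Finset.map_map]

theorem mem_range_enum {k : ℕ} (e : Fin k ↪ ι) {i : ι} :
    i ∈ Set.range e ↔ i ∈ Finset.univ.map e := by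
  simp

theorem isProbabilityMeasure_empOn (z : ι → E) {u : Finset ι} (hu : u.Nonempty) :
    IsProbabilityMeasure (empOn z u) := by
  refine ⟨?_⟩
  simp only [empOn, Measure.smul_apply, Measure.finsetSum_apply, measure_univ, smul_eq_mul,
    Finset.sum_const, nsmul_eq_mul, mul_one]
  exact ENNReal.inv_mul_cancel (by simpa using hu.ne_empty) (by simp)

theorem empOn_swap [DecidableEq ι] (z : ι → E) {u : Finset ι} {i j : ι} (hi : i ∉ u)
    (hj : j ∉ u) : empOn (fun a => z (Equiv.swap i j a)) u = empOn z u := by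
  unfold empOn
  congr 1
  refine Finset.sum_congr rfl fun a ha => ?_
  beta_reduce
  rw [Equiv.swap_apply_of_ne_of_ne (by rintro rfl; exact hi ha) (by rintro rfl; exact hj ha)]

end Empirical

/-! ### The assumptions in terms of subfamilies -/

section Conditions

variable {E ι : Type*} [MeasurableSpace E] {D : E → Measure E → ℝ}

theorem measurable_depth_empOn
    (hDm : ∀ k : ℕ, Measurable fun p : E × (Fin (k + 1) → E) => D p.1 (empiricalMeasure p.2))
    {u : Finset ι} (hu : u.Nonempty) (i : ι) :
    Measurable fun z : ι → E => D (z i) (empOn z u) := by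
  obtain ⟨k, hk⟩ := Nat.exists_eq_add_one.2 hu.card_pos
  obtain ⟨e, rfl⟩ := exists_enum u hk
  simp_rw [empOn_map]
  exact (hDm k).comp (g := fun p : E × (Fin (k + 1) → E) => D p.1 (empiricalMeasure p.2))
    (f := fun z : ι → E => (z i, fun a => z (e a))) (by fun_prop)

variable {F : Measure E} [IsProbabilityMeasure F]

/-- Stability of the depth when one observation is left out. -/
theorem CondA3.ae_insert [DecidableEq ι] (h : CondA3 D F) :
    ∃ (C : ℝ) (N : ℕ), 0 < C ∧ ∀ (u : Finset ι) (i : ι), i ∉ u → N ≤ u.card →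
      ∀ᵐ z ∂iidMeasure F ι, ∀ x,
        |D x (empOn z (insert i u)) - D x (empOn z u)| ≤ C / ((u.card + 1 : ℕ) : ℝ) := by
  obtain ⟨C, N, h⟩ := h
  refine ⟨|C| + 1, N, by positivity, fun u i hi hN => ?_⟩
  obtain ⟨e, he⟩ := exists_enum u rfl
  have hir : ∀ a, e a ≠ i := by
    intro a h
    exact hi (he ▸ h ▸ Finset.mem_map_of_mem _ (Finset.mem_univ a))
  let e' : Fin (u.card + 1) ↪ ι := ⟨Fin.cons i e, Fin.cons_injective_iff.2
    ⟨by rintro ⟨a, ha⟩; exact hir a ha, e.injective⟩⟩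
  have he' : Finset.univ.map e' = insert i u := by
    conv_rhs => rw [← he]
    ext a
    simp only [Finset.mem_map, Finset.mem_univ, true_and, Finset.mem_insert, e',
      Function.Embedding.coeFn_mk, Fin.exists_fin_succ, Fin.cons_zero, Fin.cons_succ]
    constructor <;> rintro (h | h) <;> simp_all
  have hp := measurePreserving_sample F e'
  have := h u.card (by omega)
  rw [← hp.map_eq] at this
  filter_upwards [ae_of_ae_map hp.measurable.aemeasurable this] with z hz x
  rw [← he', empOn_map]
  have h2 := hz x
  have h3 : empOn z u = empiricalMeasure (Fin.tail fun a => z (e' a)) := by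
    conv_lhs => rw [← he]
    rw [empOn_map]
    rfl
  rw [h3]
  refine h2.trans ?_
  gcongr
  linarith [le_abs_self C]

theorem lintegral_le_sqrt_lintegral_sq {α : Type*} [MeasurableSpace α] (μ : Measure α)
    [IsProbabilityMeasure μ] {f : α → ℝ≥0∞} (hf : AEMeasurable f μ) :
    ∫⁻ a, f a ∂μ ≤ (∫⁻ a, f a ^ 2 ∂μ) ^ (1 / 2 : ℝ) := by
  have := ENNReal.lintegral_mul_le_Lp_mul_Lq μ Real.HolderConjugate.two_two hf
    (aemeasurable_const (b := (1 : ℝ≥0∞)))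
  simpa using this

/-- Two new observations `i`, `j` are in a `c`-near tie with respect to the depth of the sample
`u`. -/
def nearTie (D : E → Measure E → ℝ) (u : Finset ι) (c : ℝ) (i j : ι) : Set (ι → E) :=
  {z | |D (z i) (empOn z u) - D (z j) (empOn z u)| ≤ c}

theorem measurableSet_nearTie
    (hDm : ∀ k : ℕ, Measurable fun p : E × (Fin (k + 1) → E) => D p.1 (empiricalMeasure p.2))
    {u : Finset ι} (hu : u.Nonempty) (c : ℝ) (i j : ι) :
    MeasurableSet (nearTie D u c i j) :=
  measurableSet_le ((measurable_depth_empOn hDm hu i).sub (measurable_depth_empOn hDm hu j)).abs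
    measurable_const

/-- Near ties at scale `1/m` have probability `O(m^{-β})`, and two disjoint pairs are simultaneously
near ties with probability `O(m^{-2β})`. -/
theorem CondA4.nearTie_le {β : ℝ} (h : CondA4 D F β)
    (hDm : ∀ k : ℕ, Measurable fun p : E × (Fin (k + 1) → E) => D p.1 (empiricalMeasure p.2))
    {C : ℝ} (hC : 0 < C) :
    ∃ (K : ℝ) (N : ℕ), 0 ≤ K ∧ ∀ u : Finset ι, N ≤ u.card →
      (∀ i j, i ≠ j → i ∉ u → j ∉ u →
        (iidMeasure F ι).real (nearTie D u (C / ((u.card + 1 : ℕ) : ℝ)) i j)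
          ≤ K * ((u.card + 1 : ℕ) : ℝ) ^ (-β)) ∧
      (∀ i j i' j', i ≠ j → i' ≠ j' → i ≠ i' → i ≠ j' → j ≠ i' → j ≠ j' →
        i ∉ u → j ∉ u → i' ∉ u → j' ∉ u →
        (iidMeasure F ι).real (nearTie D u (C / ((u.card + 1 : ℕ) : ℝ)) i j ∩
            nearTie D u (C / ((u.card + 1 : ℕ) : ℝ)) i' j')
          ≤ K ^ 2 * ((u.card + 1 : ℕ) : ℝ) ^ (-(2 * β))) := by
  obtain ⟨K, N, h⟩ := h C hC
  refine ⟨√|K|, N + 1, by positivity, fun u hN => ?_⟩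
  obtain ⟨k, hk⟩ : ∃ k, u.card = k + 1 := Nat.exists_eq_add_one.2 (by omega)
  obtain ⟨e, rfl⟩ := exists_enum u hk
  have hk1 : (0 : ℝ) < ((k + 1 + 1 : ℕ) : ℝ) := by positivity
  set c : ℝ := C / ((k + 1 + 1 : ℕ) : ℝ) with hc
  -- the indicator of a near tie as a function of the pair and the sample
  let A : Set ((E × E) × (Fin (k + 1) → E)) :=
    {q | |D q.1.1 (empiricalMeasure q.2) - D q.1.2 (empiricalMeasure q.2)| ≤ c}
  have hA : MeasurableSet A := by
    refine measurableSet_le (Measurable.abs (Measurable.sub ?_ ?_)) measurable_const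
    · exact (hDm k).comp (g := fun p : E × (Fin (k + 1) → E) => D p.1 (empiricalMeasure p.2))
        (f := fun q : (E × E) × (Fin (k + 1) → E) => (q.1.1, q.2)) (by fun_prop)
    · exact (hDm k).comp (g := fun p : E × (Fin (k + 1) → E) => D p.1 (empiricalMeasure p.2))
        (f := fun q : (E × E) × (Fin (k + 1) → E) => (q.1.2, q.2)) (by fun_prop)
  let Φ : (E × E) × (Fin (k + 1) → E) → ℝ≥0∞ := A.indicator 1
  have hΦ : Measurable Φ := measurable_one.indicator hA
  let q : (Fin (k + 1) → E) → ℝ≥0∞ := fun x => ∫⁻ p, Φ (p, x) ∂(F.prod F)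
  have hq : Measurable q := Measurable.lintegral_prod_left hΦ
  have hsq : ∫⁻ x, q x ^ 2 ∂(Measure.pi fun _ : Fin (k + 1) => F)
      ≤ ENNReal.ofReal (|K| * ((k + 1 + 1 : ℕ) : ℝ) ^ (-(2 * β))) := by
    have h1 := h (k + 1) (by rw [hk] at hN; omega)
    refine le_trans (le_of_eq ?_) (h1.trans (ENNReal.ofReal_le_ofReal ?_))
    · refine lintegral_congr fun x => ?_
      congr 1
      have : ∀ p, Φ (p, x) = {p : E × E | |D p.1 (empiricalMeasure x) - D p.2 (empiricalMeasure x)|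
          ≤ C / ((k + 1 + 1 : ℕ) : ℝ)}.indicator 1 p := fun p => rfl
      simp only [q, this]
      rw [lintegral_indicator_one]
      exact hA.preimage (measurable_prodMk_right (y := x))
    · gcongr
      exact le_abs_self K
  have hmem : ∀ i j (z : ι → E), z ∈ nearTie D (Finset.univ.map e) c i j ↔
      ((z i, z j), fun a => z (e a)) ∈ A := by
    intro i j z
    simp [nearTie, empOn_map, A]
  have hmeasN : ∀ i j, MeasurableSet (nearTie (ι := ι) D (Finset.univ.map e) c i j) := fun i j =>
    measurableSet_nearTie hDm (Finset.card_pos.1 (by omega)) c i j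
  have hind : ∀ i j (z : ι → E), (nearTie D (Finset.univ.map e) c i j).indicator 1 z =
      Φ ((z i, z j), fun a => z (e a)) := by
    intro i j z
    classical
    simp only [Φ, Set.indicator_apply, hmem, Pi.one_apply]
  rw [hk]
  constructor
  · intro i j hij hi hj
    rw [← mem_range_enum] at hi hj
    rw [measureReal_def]
    refine ENNReal.toReal_le_of_le_ofReal (by positivity) ?_
    rw [← lintegral_indicator_one (hmeasN i j)]
    simp_rw [hind]
    rw [lintegral_pair_sample F e hij hi hj hΦ]
    refine (lintegral_le_sqrt_lintegral_sq _ hq.aemeasurable).trans ?_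
    refine (ENNReal.rpow_le_rpow hsq (by norm_num)).trans (le_of_eq ?_)
    rw [ENNReal.ofReal_rpow_of_nonneg (by positivity) (by norm_num),
      Real.mul_rpow (by positivity) (by positivity), ← Real.rpow_mul (by positivity),
      ← Real.sqrt_eq_rpow]
    congr 3
    ring
  · intro i j i' j' hij hij' hii' hi_j' hj_i' hjj' hi hj hi' hj'
    rw [← mem_range_enum] at hi hj hi' hj'
    rw [measureReal_def]
    refine ENNReal.toReal_le_of_le_ofReal (by positivity) ?_
    rw [← lintegral_indicator_one ((hmeasN i j).inter (hmeasN i' j')), Real.sq_sqrt (abs_nonneg _)]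
    simp_rw [Set.inter_indicator_one, Pi.mul_apply, hind]
    rw [lintegral_two_pairs_sample F e hij hij' hii' hi_j' hj_i' hjj' hi hj hi' hj' hΦ]
    exact hsq

/-- By the continuity assumption on the population depth, `δ`-near ties in the population depth have
probability `O(δ^β)`. -/
theorem CondA1.near_le {β : ℝ} (h : CondA1 D F β) (hβ : 0 < β) (hD0 : ∀ x, 0 ≤ D x F)
    (hD_meas : Measurable fun x => D x F) :
    ∃ C : ℝ, 0 < C ∧ ∀ δ, 0 ≤ δ →
      (F.prod F) {p | |D p.1 F - D p.2 F| ≤ δ} ≤ ENNReal.ofReal (C * δ ^ β) := by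
  obtain ⟨C, hC, h⟩ := h
  refine ⟨C * 2 ^ β, by positivity, fun δ hδ => ?_⟩
  rw [Measure.prod_apply]
  · have : ∀ x, F (Prod.mk x ⁻¹' {p : E × E | |D p.1 F - D p.2 F| ≤ δ})
        ≤ ENNReal.ofReal (C * 2 ^ β * δ ^ β) := by
      intro x
      have h1 := h (max 0 (D x F - δ)) (D x F + δ) (le_max_left _ _) (by linarith [hD0 x])
      rw [← ofReal_measureReal]
      refine ENNReal.ofReal_le_ofReal (le_trans ?_ (h1.trans ?_))
      · refine measureReal_mono fun y hy => ?_
        simp only [Set.mem_preimage, Set.mem_ofPred_eq, abs_le] at hy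
        exact ⟨max_le (hD0 y) (by linarith), by linarith⟩
      · rw [mul_assoc, ← Real.mul_rpow (by norm_num) hδ]
        gcongr
        rw [abs_of_nonneg]
        · linarith [le_max_right 0 (D x F - δ)]
        · rw [sub_nonneg]
          exact max_le (by linarith [hD0 x]) (by linarith)
    refine (lintegral_mono this).trans ?_
    simp
  · exact measurableSet_le
      ((hD_meas.comp measurable_fst).sub (hD_meas.comp measurable_snd)).abs measurable_const

/-- In mean, comparing two new observations by the depth of a sample of size `m` differs from
comparing them by the population depth by `O(m^{-β/2})`. -/
theorem integral_signKernel_sub_le {β : ℝ} (hβ : 0 < β) (hA1 : CondA1 D F β) (hA2 : CondA2 D F β)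
    (hD : ∀ (x : E) (H : Measure E) [IsProbabilityMeasure H], 0 ≤ D x H ∧ D x H ≤ 1)
    (hD_meas : Measurable fun x => D x F)
    (hDm : ∀ k : ℕ, Measurable fun p : E × (Fin (k + 1) → E) => D p.1 (empiricalMeasure p.2)) :
    ∃ (K : ℝ) (N : ℕ), 0 ≤ K ∧ ∀ (u : Finset ι) (i j : ι), N ≤ u.card → i ≠ j → i ∉ u → j ∉ u →
      ∫ z, |signKernel (D (z i) (empOn z u)) (D (z j) (empOn z u))
          - signKernel (D (z i) F) (D (z j) F)| ∂iidMeasure F ι ≤ K * (u.card : ℝ) ^ (-(β / 2)) := by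
  obtain ⟨C, hC, hA1⟩ := hA1.near_le hβ (fun x => (hD x F).1) hD_meas
  obtain ⟨K, N, hA2⟩ := hA2
  refine ⟨√((C * 2 ^ β) ^ 2 * |K|), N + 1, by positivity, fun u i j hN hij hi hj => ?_⟩
  obtain ⟨k, hk⟩ : ∃ k, u.card = k + 1 := Nat.exists_eq_add_one.2 (by omega)
  obtain ⟨e, rfl⟩ := exists_enum u hk
  rw [← mem_range_enum] at hi hj
  let Φ : (E × E) × (Fin (k + 1) → E) → ℝ≥0∞ := fun q => ENNReal.ofReal
    |signKernel (D q.1.1 (empiricalMeasure q.2)) (D q.1.2 (empiricalMeasure q.2))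
      - signKernel (D q.1.1 F) (D q.1.2 F)|
  have hΦ : Measurable Φ := by
    refine (Measurable.abs (Measurable.sub (Measurable.signKernel ?_ ?_)
      (Measurable.signKernel ?_ ?_))).ennreal_ofReal
    · exact (hDm k).comp (g := fun p : E × (Fin (k + 1) → E) => D p.1 (empiricalMeasure p.2))
        (f := fun q : (E × E) × (Fin (k + 1) → E) => (q.1.1, q.2)) (by fun_prop)
    · exact (hDm k).comp (g := fun p : E × (Fin (k + 1) → E) => D p.1 (empiricalMeasure p.2))
        (f := fun q : (E × E) × (Fin (k + 1) → E) => (q.1.2, q.2)) (by fun_prop)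
    · exact hD_meas.comp (by fun_prop : Measurable
        fun q : (E × E) × (Fin (k + 1) → E) => q.1.1)
    · exact hD_meas.comp (by fun_prop : Measurable
        fun q : (E × E) × (Fin (k + 1) → E) => q.1.2)
  let q : (Fin (k + 1) → E) → ℝ≥0∞ := fun x => ∫⁻ p, Φ (p, x) ∂(F.prod F)
  have hq : Measurable q := Measurable.lintegral_prod_left hΦ
  -- the supremum of the depth deviations need not be measurable, but it dominates the measurable `q`
  have hpt : ∀ x, q x ^ 2 ≤ ENNReal.ofReal ((C * 2 ^ β) ^ 2) *
      (⨆ z, ENNReal.ofReal |D z (empiricalMeasure x) - D z F|) ^ (2 * β) := by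
    intro x
    have : IsProbabilityMeasure (empiricalMeasure x) := by
      have := isProbabilityMeasure_empOn x (u := Finset.univ) Finset.univ_nonempty
      simpa [empOn, empiricalMeasure] using this
    set S := ⨆ z, ENNReal.ofReal |D z (empiricalMeasure x) - D z F| with hS
    have hS1 : S ≤ 1 := by
      refine iSup_le fun z => ENNReal.ofReal_le_one.2 ?_
      have h1 := hD z (empiricalMeasure x)
      have h2 := hD z F
      rw [abs_le]; constructor <;> linarith
    have hStop : S ≠ ∞ := ne_top_of_le_ne_top ENNReal.one_ne_top hS1
    have hdiff : ∀ z, |D z (empiricalMeasure x) - D z F| ≤ S.toReal := fun z => by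
      rw [← ENNReal.ofReal_le_iff_le_toReal hStop]
      exact le_iSup (fun z => ENNReal.ofReal |D z (empiricalMeasure x) - D z F|) z
    have hqx : q x ≤ ENNReal.ofReal (C * (2 * S.toReal) ^ β) := by
      refine le_trans ?_ (hA1 (2 * S.toReal) (by positivity))
      have hset : MeasurableSet {p : E × E | |D p.1 F - D p.2 F| ≤ 2 * S.toReal} :=
        measurableSet_le ((hD_meas.comp measurable_fst).sub (hD_meas.comp measurable_snd)).abs
          measurable_const
      rw [← lintegral_indicator_one hset]
      refine lintegral_mono fun p => ?_
      have h1 := abs_signKernel_sub_le (hdiff p.1) (hdiff p.2)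
      simp only [Φ, Set.indicator_apply, Set.mem_ofPred_eq, Pi.one_apply]
      refine (ENNReal.ofReal_le_ofReal h1).trans ?_
      split_ifs <;> simp
    calc q x ^ 2 ≤ ENNReal.ofReal (C * (2 * S.toReal) ^ β) ^ 2 := by gcongr
      _ = ENNReal.ofReal ((C * 2 ^ β) ^ 2) * S ^ (2 * β) := by
        rw [Real.mul_rpow (by norm_num) (by positivity), ← mul_assoc,
          ENNReal.ofReal_mul (by positivity), mul_pow, ENNReal.ofReal_pow (by positivity),
          ← ENNReal.ofReal_rpow_of_nonneg (by positivity) hβ.le, ENNReal.ofReal_toReal hStop,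
          mul_comm 2 β, ENNReal.rpow_mul]
        norm_cast
  have hsq : ∫⁻ x, q x ^ 2 ∂(Measure.pi fun _ : Fin (k + 1) => F)
      ≤ ENNReal.ofReal ((C * 2 ^ β) ^ 2 * |K| * ((k + 1 : ℕ) : ℝ) ^ (-β)) := by
    refine (lintegral_mono hpt).trans ?_
    rw [lintegral_const_mul' _ _ ENNReal.ofReal_ne_top, mul_assoc,
      ENNReal.ofReal_mul (by positivity)]
    gcongr
    refine (hA2 (k + 1) (by rw [hk] at hN; omega)).trans (ENNReal.ofReal_le_ofReal ?_)
    gcongr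
    exact le_abs_self K
  rw [hk]
  have hm1 : Measurable fun z : ι → E =>
      |signKernel (D (z i) (empOn z (Finset.univ.map e))) (D (z j) (empOn z (Finset.univ.map e)))
          - signKernel (D (z i) F) (D (z j) F)| := by
    have hne : (Finset.univ.map e).Nonempty := Finset.card_pos.1 (by omega)
    exact (((measurable_depth_empOn hDm hne i).signKernel (measurable_depth_empOn hDm hne j)).sub
      ((hD_meas.comp (measurable_pi_apply i)).signKernel
        (hD_meas.comp (measurable_pi_apply j)))).abs
  rw [integral_eq_lintegral_of_nonneg_ae (ae_of_all _ fun z => abs_nonneg _)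
    hm1.aestronglyMeasurable]
  refine ENNReal.toReal_le_of_le_ofReal (by positivity) ?_
  have := lintegral_pair_sample F e hij hi hj hΦ
  simp only [Φ] at this
  simp_rw [empOn_map]
  rw [this]
  refine (lintegral_le_sqrt_lintegral_sq _ hq.aemeasurable).trans ?_
  refine (ENNReal.rpow_le_rpow hsq (by norm_num)).trans (le_of_eq ?_)
  rw [ENNReal.ofReal_rpow_of_nonneg (by positivity) (by norm_num),
    Real.mul_rpow (by positivity) (by positivity), ← Real.rpow_mul (by positivity),
    ← Real.sqrt_eq_rpow]
  congr 3
  ring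

end Conditions

/-! ### Second moments of double averages -/

section DoubleAverage

variable {ι : Type*}

/-- The average of the array `V i j` over `i ∈ s` and `j ∈ t`. -/
noncomputable def doubleAvg (s t : Finset ι) (V : ι → ι → ℝ) : ℝ :=
  (s.card : ℝ)⁻¹ * (t.card : ℝ)⁻¹ * ∑ i ∈ s, ∑ j ∈ t, V i j

theorem Measurable.doubleAvg {α : Type*} [MeasurableSpace α] {s t : Finset ι}
    {V : ι → ι → α → ℝ} (hV : ∀ i ∈ s, ∀ j ∈ t, Measurable (V i j)) :
    Measurable fun z => doubleAvg s t fun i j => V i j z := by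
  unfold _root_.doubleAvg
  exact (Finset.measurable_fun_sum _ fun i hi => Finset.measurable_fun_sum _ fun j hj =>
    hV i hi j hj).const_mul _

theorem abs_doubleAvg_le {s t : Finset ι} {V : ι → ι → ℝ} {B : ℝ} (hB : 0 ≤ B)
    (h : ∀ i ∈ s, ∀ j ∈ t, |V i j| ≤ B) : |doubleAvg s t V| ≤ B := by
  have h1 : |∑ i ∈ s, ∑ j ∈ t, V i j| ≤ s.card * (t.card * B) := by
    refine (Finset.abs_sum_le_sum_abs _ _).trans ?_
    rw [← nsmul_eq_mul]
    refine Finset.sum_le_card_nsmul _ _ _ fun i hi => ?_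
    refine (Finset.abs_sum_le_sum_abs _ _).trans ?_
    rw [← nsmul_eq_mul]
    exact Finset.sum_le_card_nsmul _ _ _ fun j hj => h i hi j hj
  rw [doubleAvg, abs_mul, abs_of_nonneg (by positivity : (0 : ℝ) ≤ (s.card : ℝ)⁻¹ * _)]
  refine (mul_le_mul_of_nonneg_left h1 (by positivity)).trans ?_
  have e1 : (s.card : ℝ)⁻¹ * s.card ≤ 1 := inv_mul_le_one
  have e2 : (t.card : ℝ)⁻¹ * t.card ≤ 1 := inv_mul_le_one
  calc (s.card : ℝ)⁻¹ * (t.card : ℝ)⁻¹ * (s.card * (t.card * B))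
      = ((s.card : ℝ)⁻¹ * s.card) * ((t.card : ℝ)⁻¹ * t.card) * B := by ring
    _ ≤ 1 * 1 * B := by gcongr
    _ = B := by ring

theorem integrable_of_abs_le {α : Type*} [MeasurableSpace α] {μ : Measure α} [IsFiniteMeasure μ]
    {f : α → ℝ} (hf : Measurable f) {B : ℝ} (h : ∀ z, |f z| ≤ B) : Integrable f μ :=
  Integrable.of_bound hf.aestronglyMeasurable B (ae_of_all _ h)

theorem integral_abs_doubleAvg_le {α : Type*} [MeasurableSpace α] {μ : Measure α}
    [IsProbabilityMeasure μ] {s t : Finset ι} {V : ι → ι → α → ℝ} {B : ℝ} (hB : 0 ≤ B)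
    (hV : ∀ i ∈ s, ∀ j ∈ t, Integrable (V i j) μ)
    (h : ∀ i ∈ s, ∀ j ∈ t, ∫ z, |V i j z| ∂μ ≤ B) :
    ∫ z, |doubleAvg s t fun i j => V i j z| ∂μ ≤ B := by
  have hi : ∀ i ∈ s, ∀ j ∈ t, Integrable (fun z => |V i j z|) μ := fun i hi j hj =>
    (hV i hi j hj).abs
  calc ∫ z, |doubleAvg s t fun i j => V i j z| ∂μ
      ≤ ∫ z, doubleAvg s t (fun i j => |V i j z|) ∂μ := by
        refine integral_mono_of_nonneg (ae_of_all _ fun z => abs_nonneg _) ?_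
          (ae_of_all _ fun z => ?_)
        · exact (integrable_finsetSum _ fun i h1 => integrable_finsetSum _ fun j h2 =>
            hi i h1 j h2).const_mul _
        · simp only [doubleAvg]
          rw [abs_mul, abs_of_nonneg (by positivity : (0 : ℝ) ≤ (s.card : ℝ)⁻¹ * _)]
          gcongr
          exact (Finset.abs_sum_le_sum_abs _ _).trans
            (Finset.sum_le_sum fun i _ => Finset.abs_sum_le_sum_abs _ _)
    _ = doubleAvg s t fun i j => ∫ z, |V i j z| ∂μ := by
        simp only [doubleAvg]
        rw [integral_const_mul, integral_finsetSum _ fun i h1 =>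
          integrable_finsetSum _ fun j h2 => hi i h1 j h2]
        congr 1
        exact Finset.sum_congr rfl fun i h1 => integral_finsetSum _ fun j h2 => hi i h1 j h2
    _ ≤ B := by
        refine (le_abs_self _).trans (abs_doubleAvg_le hB fun i h1 j h2 => ?_)
        rw [abs_of_nonneg (integral_nonneg fun z => abs_nonneg _)]
        exact h i h1 j h2

/-- The second moment of a double average, when the mixed moments are at most `η`, with an extra
`ε` for each index in common and an extra `ζ` on the diagonal. -/
theorem integral_doubleAvg_sq_le [DecidableEq ι] {α : Type*} [MeasurableSpace α] {μ : Measure α}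
    [IsProbabilityMeasure μ] {s t : Finset ι} (hs : s.Nonempty) (ht : t.Nonempty)
    {V : ι → ι → α → ℝ} {B : ℝ}
    (hV : ∀ i ∈ s, ∀ j ∈ t, Measurable (V i j)) (hB : ∀ i j z, |V i j z| ≤ B) {ε η ζ : ℝ}
    (h : ∀ i ∈ s, ∀ j ∈ t, ∀ k ∈ s, ∀ l ∈ t, ∫ z, V i j z * V k l z ∂μ
      ≤ η + (if i = k then ε else 0) + (if j = l then ε else 0)
        + if i = k ∧ j = l then ζ else 0) :
    ∫ z, (doubleAvg s t fun i j => V i j z) ^ 2 ∂μ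
      ≤ η + ((s.card : ℝ)⁻¹ + (t.card : ℝ)⁻¹) * ε + (s.card : ℝ)⁻¹ * (t.card : ℝ)⁻¹ * ζ := by
  have hint : ∀ p ∈ s ×ˢ t, ∀ q ∈ s ×ˢ t,
      Integrable (fun z => V p.1 p.2 z * V q.1 q.2 z) μ := by
    intro p hp q hq
    rw [Finset.mem_product] at hp hq
    refine integrable_of_abs_le ((hV _ hp.1 _ hp.2).mul (hV _ hq.1 _ hq.2)) (B := B * B) fun z => ?_
    rw [abs_mul]
    exact mul_le_mul (hB _ _ z) (hB _ _ z) (abs_nonneg _) ((abs_nonneg _).trans (hB p.1 p.2 z))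
  have hexp : ∀ z, (doubleAvg s t fun i j => V i j z) ^ 2
      = ((s.card : ℝ)⁻¹ * (t.card : ℝ)⁻¹) ^ 2 *
        ∑ p ∈ s ×ˢ t, ∑ q ∈ s ×ˢ t, V p.1 p.2 z * V q.1 q.2 z := by
    intro z
    rw [doubleAvg, mul_pow, ← Finset.sum_product', sq (∑ p ∈ s ×ˢ t, _), Finset.sum_mul_sum]
  have hm : (s.card : ℝ) ≠ 0 := by simpa using hs.ne_empty
  have hn : (t.card : ℝ) ≠ 0 := by simpa using ht.ne_empty
  simp_rw [hexp]
  rw [integral_const_mul, integral_finsetSum _ fun p hp => integrable_finsetSum _ fun q hq =>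
    hint p hp q hq]
  have hsum : ∑ p ∈ s ×ˢ t, ∫ z, ∑ q ∈ s ×ˢ t, V p.1 p.2 z * V q.1 q.2 z ∂μ
      ≤ ∑ p ∈ s ×ˢ t, (s.card * t.card * η + t.card * ε + s.card * ε + ζ) := by
    refine Finset.sum_le_sum fun p hp => ?_
    rw [integral_finsetSum _ fun q hq => hint p hp q hq]
    have hp' := Finset.mem_product.1 hp
    calc _ ≤ ∑ q ∈ s ×ˢ t, (η + (if p.1 = q.1 then ε else 0) + (if p.2 = q.2 then ε else 0)
            + if p.1 = q.1 ∧ p.2 = q.2 then ζ else 0) := by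
          refine Finset.sum_le_sum fun q hq => ?_
          have hq' := Finset.mem_product.1 hq
          exact h _ hp'.1 _ hp'.2 _ hq'.1 _ hq'.2
      _ = _ := by
          rw [Finset.sum_product]
          have e1 : ∀ k, (∑ l ∈ t, if p.1 = k then ε else 0)
              = if p.1 = k then (t.card : ℝ) * ε else 0 := by
            intro k; split_ifs <;> simp
          have e2 : ∀ k, (∑ l ∈ t, if p.1 = k ∧ p.2 = l then ζ else 0)
              = if p.1 = k then ζ else 0 := by
            intro k
            by_cases hk : p.1 = k <;> simp [hk, hp'.2]
          simp only [Finset.sum_add_distrib, Finset.sum_const, e1, e2, Finset.sum_ite_eq,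
            hp'.1, hp'.2, if_true, nsmul_eq_mul]
          ring
  refine (mul_le_mul_of_nonneg_left hsum (by positivity)).trans (le_of_eq ?_)
  rw [Finset.sum_const, Finset.card_product, nsmul_eq_mul]
  push_cast
  field_simp
  ring

end DoubleAverage

/-! ### Comparisons under the sample depth and under the population depth -/

/-- The standing assumptions on the depth function `D` at the law `F`. -/
structure RegularDepth {E : Type*} [MeasurableSpace E] (D : E → Measure E → ℝ) (F : Measure E)
    (β : ℝ) : Prop where
  half_lt : 1 / 2 < β
  mem_Icc : ∀ (x : E) (H : Measure E) [IsProbabilityMeasure H], 0 ≤ D x H ∧ D x H ≤ 1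
  measurable_pop : Measurable fun x => D x F
  measurable_emp : ∀ k : ℕ, Measurable fun p : E × (Fin (k + 1) → E) => D p.1 (empiricalMeasure p.2)
  condA1 : CondA1 D F β
  condA2 : CondA2 D F β
  condA3 : CondA3 D F
  condA4 : CondA4 D F β

section Kernels

variable {E ι : Type*} [MeasurableSpace E]

/-- The comparison of the observations `i` and `j` by the depth of the subsample `u`. -/
noncomputable def sampleKernel (D : E → Measure E → ℝ) (u : Finset ι) (i j : ι) (z : ι → E) : ℝ :=
  signKernel (D (z i) (empOn z u)) (D (z j) (empOn z u))

/-- The comparison of the observations `i` and `j` by the population depth. -/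
noncomputable def popKernel (D : E → Measure E → ℝ) (F : Measure E) (i j : ι) (z : ι → E) : ℝ :=
  signKernel (D (z i) F) (D (z j) F)

variable {D : E → Measure E → ℝ} {F : Measure E} {β : ℝ}

theorem abs_sampleKernel_sub_sampleKernel_le (u v : Finset ι) (i j : ι) (z : ι → E) :
    |sampleKernel D u i j z - sampleKernel D v i j z| ≤ 1 := by
  refine (abs_sub _ _).trans ((add_le_add (abs_signKernel_le _ _)
    (abs_signKernel_le _ _)).trans (by norm_num))

theorem abs_sampleKernel_sub_popKernel_le (u : Finset ι) (i j : ι) (z : ι → E) :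
    |sampleKernel D u i j z - popKernel D F i j z| ≤ 1 := by
  refine (abs_sub _ _).trans ((add_le_add (abs_signKernel_le _ _)
    (abs_signKernel_le _ _)).trans (by norm_num))

theorem measurable_popKernel (h : RegularDepth D F β) (i j : ι) :
    Measurable (popKernel D F i j) :=
  (h.measurable_pop.comp (measurable_pi_apply i)).signKernel
    (h.measurable_pop.comp (measurable_pi_apply j))

theorem measurable_sampleKernel (h : RegularDepth D F β) {u : Finset ι} (hu : u.Nonempty)
    (i j : ι) : Measurable (sampleKernel D u i j) :=
  (measurable_depth_empOn h.measurable_emp hu i).signKernel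
    (measurable_depth_empOn h.measurable_emp hu j)

variable [DecidableEq ι]

theorem sampleKernel_swap {u : Finset ι} {i j : ι} (hi : i ∉ u) (hj : j ∉ u) (z : ι → E) :
    sampleKernel D u i j (fun a => z (Equiv.swap i j a)) = -sampleKernel D u i j z := by
  unfold sampleKernel
  beta_reduce
  rw [empOn_swap z hi hj, Equiv.swap_apply_left, Equiv.swap_apply_right, signKernel_swap]

theorem sampleKernel_swap_of_ne {u : Finset ι} {i j k l : ι} (hi : i ∉ u) (hj : j ∉ u)
    (hki : k ≠ i) (hkj : k ≠ j) (hli : l ≠ i) (hlj : l ≠ j) (z : ι → E) :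
    sampleKernel D u k l (fun a => z (Equiv.swap i j a)) = sampleKernel D u k l z := by
  unfold sampleKernel
  beta_reduce
  rw [empOn_swap z hi hj, Equiv.swap_apply_of_ne_of_ne hki hkj, Equiv.swap_apply_of_ne_of_ne hli hlj]

theorem popKernel_swap (i j : ι) (z : ι → E) :
    popKernel D F i j (fun a => z (Equiv.swap i j a)) = -popKernel D F i j z := by
  unfold popKernel
  beta_reduce
  rw [Equiv.swap_apply_left, Equiv.swap_apply_right, signKernel_swap]

theorem popKernel_swap_of_ne {i j k l : ι}
    (hki : k ≠ i) (hkj : k ≠ j) (hli : l ≠ i) (hlj : l ≠ j) (z : ι → E) :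
    popKernel D F k l (fun a => z (Equiv.swap i j a)) = popKernel D F k l z := by
  unfold popKernel
  beta_reduce
  rw [Equiv.swap_apply_of_ne_of_ne hki hkj, Equiv.swap_apply_of_ne_of_ne hli hlj]

variable [IsProbabilityMeasure F]

/-- The key covariance estimate. Split each leave-one-out factor into its leave-two-out version and
a remainder. The three products containing a leave-two-out factor are odd under the exchange of
the two observations of that pair which the other factor does not see, so they integrate to `0`;
the product of the two remainders lives on a simultaneous near tie. -/
theorem integral_kernel_mul_le (h : RegularDepth D F β) {u : Finset ι} (hu : u.Nonempty)
    {i j k l : ι} (hik : i ≠ k) (hil : i ≠ l) (hjk : j ≠ k)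
    (hjl : j ≠ l) (hi : i ∉ u) (hj : j ∉ u) (hk : k ∉ u) (hl : l ∉ u) {c : ℝ}
    (hck : ∀ᵐ z ∂iidMeasure F ι, ∀ x, |D x (empOn z (insert k u)) - D x (empOn z u)| ≤ c)
    (hci : ∀ᵐ z ∂iidMeasure F ι, ∀ x, |D x (empOn z (insert i u)) - D x (empOn z u)| ≤ c) :
    ∫ z, (sampleKernel D (insert k u) i j z - popKernel D F i j z) *
        (sampleKernel D (insert i u) k l z - popKernel D F k l z) ∂iidMeasure F ι
      ≤ (iidMeasure F ι).real (nearTie D u (2 * c) i j ∩ nearTie D u (2 * c) k l) := by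
  have hmS : ∀ {v : Finset ι}, v.Nonempty → ∀ a b, Measurable (sampleKernel D v a b) :=
    fun hv a b => measurable_sampleKernel h hv a b
  have hmP : ∀ a b : ι, Measurable (popKernel D F a b) := measurable_popKernel h
  have huk : (insert k u).Nonempty := Finset.insert_nonempty _ _
  have hui : (insert i u).Nonempty := Finset.insert_nonempty _ _
  -- leave-two-out parts and remainders
  let B1 : (ι → E) → ℝ := fun z => sampleKernel D u i j z - popKernel D F i j z
  let B2 : (ι → E) → ℝ := fun z => sampleKernel D u k l z - popKernel D F k l z
  let f1 : (ι → E) → ℝ := fun z => sampleKernel D (insert k u) i j z - sampleKernel D u i j z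
  let f2 : (ι → E) → ℝ := fun z => sampleKernel D (insert i u) k l z - sampleKernel D u k l z
  have mB1 : Measurable B1 := (hmS hu i j).sub (hmP i j)
  have mB2 : Measurable B2 := (hmS hu k l).sub (hmP k l)
  have mf1 : Measurable f1 := (hmS huk i j).sub (hmS hu i j)
  have mf2 : Measurable f2 := (hmS hui k l).sub (hmS hu k l)
  have bB1 : ∀ z, |B1 z| ≤ 1 := fun z => abs_sampleKernel_sub_popKernel_le _ _ _ _
  have bB2 : ∀ z, |B2 z| ≤ 1 := fun z => abs_sampleKernel_sub_popKernel_le _ _ _ _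
  have bf1 : ∀ z, |f1 z| ≤ 1 := fun z => abs_sampleKernel_sub_sampleKernel_le _ _ _ _ _
  have bf2 : ∀ z, |f2 z| ≤ 1 := fun z => abs_sampleKernel_sub_sampleKernel_le _ _ _ _ _
  have hint : ∀ {f g : (ι → E) → ℝ}, Measurable f → Measurable g → (∀ z, |f z| ≤ 1) →
      (∀ z, |g z| ≤ 1) → Integrable (fun z => f z * g z) (iidMeasure F ι) := by
    intro f g hf hg bf bg
    refine integrable_of_abs_le (hf.mul hg) (B := 1) fun z => ?_
    rw [abs_mul]
    exact mul_le_one₀ (bf z) (abs_nonneg _) (bg z)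
  have hiku : i ∉ insert k u := by simp [hik, hi]
  have hjku : j ∉ insert k u := by simp [hjk, hj]
  have hkiu : k ∉ insert i u := by simp [hik.symm, hk]
  have hliu : l ∉ insert i u := by simp [hil.symm, hl]
  have z1 : ∫ z, B1 z * B2 z ∂iidMeasure F ι = 0 := by
    refine integral_eq_zero_of_swap F i j (mB1.mul mB2) fun z => ?_
    simp only [B1, B2]
    rw [sampleKernel_swap hi hj, popKernel_swap,
      sampleKernel_swap_of_ne hi hj hik.symm hjk.symm hil.symm hjl.symm,
      popKernel_swap_of_ne hik.symm hjk.symm hil.symm hjl.symm]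
    ring
  have z2 : ∫ z, B1 z * f2 z ∂iidMeasure F ι = 0 := by
    refine integral_eq_zero_of_swap F k l (mB1.mul mf2) fun z => ?_
    simp only [B1, f2]
    rw [sampleKernel_swap hkiu hliu, sampleKernel_swap hk hl,
      sampleKernel_swap_of_ne hk hl hik hil hjk hjl, popKernel_swap_of_ne hik hil hjk hjl]
    ring
  have z3 : ∫ z, f1 z * B2 z ∂iidMeasure F ι = 0 := by
    refine integral_eq_zero_of_swap F i j (mf1.mul mB2) fun z => ?_
    simp only [B2, f1]
    rw [sampleKernel_swap hiku hjku, sampleKernel_swap hi hj,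
      sampleKernel_swap_of_ne hi hj hik.symm hjk.symm hil.symm hjl.symm,
      popKernel_swap_of_ne hik.symm hjk.symm hil.symm hjl.symm]
    ring
  have hsplit : ∀ z, (sampleKernel D (insert k u) i j z - popKernel D F i j z) *
        (sampleKernel D (insert i u) k l z - popKernel D F k l z)
      = B1 z * B2 z + B1 z * f2 z + f1 z * B2 z + f1 z * f2 z := by
    intro z
    simp only [B1, B2, f1, f2]
    ring
  simp_rw [hsplit]
  have i12 : Integrable (fun z => B1 z * B2 z + B1 z * f2 z) (iidMeasure F ι) :=
    (hint mB1 mB2 bB1 bB2).add (hint mB1 mf2 bB1 bf2)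
  have i123 : Integrable (fun z => B1 z * B2 z + B1 z * f2 z + f1 z * B2 z) (iidMeasure F ι) :=
    i12.add (hint mf1 mB2 bf1 bB2)
  rw [integral_add i123 (hint mf1 mf2 bf1 bf2),
    integral_add i12 (hint mf1 mB2 bf1 bB2),
    integral_add (hint mB1 mB2 bB1 bB2) (hint mB1 mf2 bB1 bf2), z1, z2, z3]
  simp only [zero_add]
  have hms : MeasurableSet (nearTie D u (2 * c) i j ∩ nearTie D u (2 * c) k l) :=
    (measurableSet_nearTie h.measurable_emp hu _ i j).inter
      (measurableSet_nearTie h.measurable_emp hu _ k l)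
  rw [← integral_indicator_one hms]
  refine integral_mono_ae (hint mf1 mf2 bf1 bf2) ((integrable_const 1).indicator hms) ?_
  filter_upwards [hck, hci] with z hzk hzi
  have e1 := abs_signKernel_sub_le (hzk (z i)) (hzk (z j))
  have e2 := abs_signKernel_sub_le (hzi (z k)) (hzi (z l))
  have e1' : |f1 z| ≤ (nearTie D u (2 * c) i j).indicator 1 z := by
    refine e1.trans (le_of_eq ?_)
    by_cases hz : |D (z i) (empOn z u) - D (z j) (empOn z u)| ≤ 2 * c
    · rw [if_pos hz, Set.indicator_of_mem (by exact hz)]; rfl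
    · rw [if_neg hz, Set.indicator_of_notMem (by exact hz)]
  have e2' : |f2 z| ≤ (nearTie D u (2 * c) k l).indicator 1 z := by
    refine e2.trans (le_of_eq ?_)
    by_cases hz : |D (z k) (empOn z u) - D (z l) (empOn z u)| ≤ 2 * c
    · rw [if_pos hz, Set.indicator_of_mem (by exact hz)]; rfl
    · rw [if_neg hz, Set.indicator_of_notMem (by exact hz)]
  rw [Set.inter_indicator_one, Pi.mul_apply]
  refine (le_abs_self _).trans ?_
  rw [abs_mul]
  exact mul_le_mul e1' e2' (abs_nonneg _) ((abs_nonneg _).trans e1')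

/-- Replacing the sample depth by its leave-one-out version in the double average that defines the
quality index costs `O(m^{-β})` in mean. -/
theorem integral_abs_avg_indicator_sub_le (h : RegularDepth D F β) :
    ∃ (K : ℝ) (N : ℕ), 0 ≤ K ∧ ∀ s t : Finset ι, Disjoint s t → N ≤ s.card →
      ∫ z, |doubleAvg s t fun i j =>
          ((if D (z i) (empOn z s) ≤ D (z j) (empOn z s) then 1 else 0) - 1 / 2)
            - sampleKernel D (s.erase i) i j z| ∂iidMeasure F ι ≤ K * (s.card : ℝ) ^ (-β) := by
  obtain ⟨C, N3, hC, h3⟩ := h.condA3.ae_insert (ι := ι)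
  obtain ⟨K, N4, hK, h4⟩ := h.condA4.nearTie_le (ι := ι) h.measurable_emp
    (C := 2 * C) (by positivity)
  refine ⟨K, max N3 N4 + 2, hK, fun s t hst hN => ?_⟩
  have hsne : s.Nonempty := Finset.card_pos.1 (by omega)
  have hne : ∀ i ∈ s, (s.erase i).Nonempty := fun i hi =>
    Finset.card_pos.1 (by rw [Finset.card_erase_of_mem hi]; omega)
  have hmeas : ∀ i ∈ s, ∀ j ∈ t, Measurable fun z : ι → E =>
      ((if D (z i) (empOn z s) ≤ D (z j) (empOn z s) then (1 : ℝ) else 0) - 1 / 2)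
            - sampleKernel D (s.erase i) i j z := fun i hi j _ =>
    ((Measurable.ite (measurableSet_le (measurable_depth_empOn h.measurable_emp hsne i)
      (measurable_depth_empOn h.measurable_emp hsne j)) measurable_const
        measurable_const).sub_const _).sub (measurable_sampleKernel h (hne i hi) i j)
  have hint : ∀ i ∈ s, ∀ j ∈ t, Integrable (fun z : ι → E =>
      ((if D (z i) (empOn z s) ≤ D (z j) (empOn z s) then (1 : ℝ) else 0) - 1 / 2)
            - sampleKernel D (s.erase i) i j z) (iidMeasure F ι) := by
    intro i hi j hj
    refine integrable_of_abs_le (hmeas i hi j hj) (B := 1) fun z => ?_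
    refine (abs_sub _ _).trans ((add_le_add ?_ (abs_signKernel_le _ _)).trans
      (le_of_eq (add_halves 1)))
    split_ifs <;> norm_num [abs_of_pos, abs_of_neg]
  refine integral_abs_doubleAvg_le (by positivity) hint fun i hi j hj => ?_
  have hjs : j ∉ s := Finset.disjoint_right.1 hst hj
  have hcard : (s.erase i).card + 1 = s.card := Finset.card_erase_add_one hi
  have hms := measurableSet_nearTie h.measurable_emp (hne i hi)
    (2 * C / (((s.erase i).card + 1 : ℕ) : ℝ)) i j
  have hb := (h4 (s.erase i) (by omega)).1 i j (by rintro rfl; exact hjs hi) (by simp) (by simp [hjs])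
  rw [← integral_indicator_one hms] at hb
  rw [hcard] at hb
  refine le_trans (integral_mono_ae (hint i hi j hj).abs ?_ ?_) hb
  · rw [← hcard]; exact (integrable_const 1).indicator hms
  · have := h3 (s.erase i) i (by simp) (by omega)
    rw [Finset.insert_erase hi, hcard] at this
    filter_upwards [this] with z hz
    have e1 := abs_indicator_sub_signKernel_le (hz (z i)) (hz (z j))
    refine e1.trans (le_of_eq ?_)
    rw [← mul_div_assoc]
    by_cases hz : |D (z i) (empOn z (s.erase i)) - D (z j) (empOn z (s.erase i))|
        ≤ 2 * C / (s.card : ℝ)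
    · rw [if_pos hz, Set.indicator_of_mem (by exact hz)]; rfl
    · rw [if_neg hz, Set.indicator_of_notMem (by exact hz)]

/-- The second moment of the average difference between the leave-one-out comparisons and the
population comparisons. -/
theorem integral_avg_kernel_sub_sq_le (h : RegularDepth D F β) :
    ∃ (K L : ℝ) (N : ℕ), ∀ s t : Finset ι, Disjoint s t → N ≤ s.card → t.Nonempty →
      ∫ z, (doubleAvg s t fun i j => sampleKernel D (s.erase i) i j z - popKernel D F i j z) ^ 2
          ∂iidMeasure F ι
        ≤ K ^ 2 * ((s.card - 1 : ℕ) : ℝ) ^ (-(2 * β)) +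
          ((s.card : ℝ)⁻¹ + (t.card : ℝ)⁻¹) * (L * ((s.card - 1 : ℕ) : ℝ) ^ (-(β / 2))) := by
  obtain ⟨C, N3, hC, h3⟩ := h.condA3.ae_insert (ι := ι)
  obtain ⟨K, N4, hK, h4⟩ := h.condA4.nearTie_le (ι := ι) h.measurable_emp
    (C := 2 * C) (by positivity)
  obtain ⟨L, N2, hL, h2⟩ := integral_signKernel_sub_le (ι := ι) (by linarith [h.half_lt])
    h.condA1 h.condA2 h.mem_Icc h.measurable_pop h.measurable_emp
  refine ⟨K, L, max (max N3 N4) N2 + 3, fun s t hst hN ht => ?_⟩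
  have hsne : s.Nonempty := Finset.card_pos.1 (by omega)
  have hne : ∀ i ∈ s, (s.erase i).Nonempty := fun i hi =>
    Finset.card_pos.1 (by rw [Finset.card_erase_of_mem hi]; omega)
  have hmeas : ∀ i ∈ s, ∀ j ∈ t, Measurable fun z : ι → E =>
      sampleKernel D (s.erase i) i j z - popKernel D F i j z := fun i hi j _ =>
    (measurable_sampleKernel h (hne i hi) i j).sub (measurable_popKernel h i j)
  have hbd : ∀ (i j : ι) (z : ι → E),
      |sampleKernel D (s.erase i) i j z - popKernel D F i j z| ≤ 1 := fun i j z =>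
    abs_sampleKernel_sub_popKernel_le _ _ _ _
  have hε : ∀ i ∈ s, ∀ j ∈ t, ∀ k ∈ s, ∀ l ∈ t,
      ∫ z, (sampleKernel D (s.erase i) i j z - popKernel D F i j z) *
        (sampleKernel D (s.erase k) k l z - popKernel D F k l z) ∂iidMeasure F ι
      ≤ L * ((s.card - 1 : ℕ) : ℝ) ^ (-(β / 2)) := by
    intro i hi j hj k hk l hl
    have hjs : j ∉ s := Finset.disjoint_right.1 hst hj
    have hcard : (s.erase i).card = s.card - 1 := Finset.card_erase_of_mem hi
    have := h2 (s.erase i) i j (by omega) (by rintro rfl; exact hjs hi) (by simp) (by simp [hjs])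
    rw [hcard] at this
    refine le_trans (integral_mono ?_ ?_ fun z => ?_) this
    · refine integrable_of_abs_le ((hmeas i hi j hj).mul (hmeas k hk l hl)) (B := 1) fun z => ?_
      rw [abs_mul]
      exact mul_le_one₀ (hbd i j z) (abs_nonneg _) (hbd k l z)
    · exact (integrable_of_abs_le (hmeas i hi j hj) (hbd i j)).abs
    · refine (le_abs_self _).trans ?_
      rw [abs_mul]
      exact mul_le_of_le_one_right (abs_nonneg _) (hbd k l z)
  have hεnn : 0 ≤ L * ((s.card - 1 : ℕ) : ℝ) ^ (-(β / 2)) := by positivity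
  have hηnn : 0 ≤ K ^ 2 * ((s.card - 1 : ℕ) : ℝ) ^ (-(2 * β)) := by positivity
  have := integral_doubleAvg_sq_le (μ := iidMeasure F ι) hsne ht hmeas hbd
    (ε := L * ((s.card - 1 : ℕ) : ℝ) ^ (-(β / 2)))
    (η := K ^ 2 * ((s.card - 1 : ℕ) : ℝ) ^ (-(2 * β))) (ζ := 0) ?_
  · simpa using this
  intro i hi j hj k hk l hl
  simp only [ite_self, add_zero]
  have hjs : j ∉ s := Finset.disjoint_right.1 hst hj
  have hls : l ∉ s := Finset.disjoint_right.1 hst hl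
  by_cases hik : i = k
  · rw [if_pos hik]
    have := hε i hi j hj k hk l hl
    split_ifs <;> linarith
  by_cases hjl : j = l
  · rw [if_neg hik, if_pos hjl]
    have := hε i hi j hj k hk l hl
    linarith
  rw [if_neg hik, if_neg hjl, add_zero, add_zero]
  have hki : k ∈ s.erase i := Finset.mem_erase.2 ⟨Ne.symm hik, hk⟩
  have hik' : i ∈ s.erase k := Finset.mem_erase.2 ⟨hik, hi⟩
  set u := (s.erase i).erase k with hu
  have hcard : u.card + 2 = s.card := by
    rw [hu, Finset.card_erase_of_mem hki, Finset.card_erase_of_mem hi]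
    omega
  have hins1 : insert k u = s.erase i := Finset.insert_erase hki
  have hins2 : insert i u = s.erase k := by
    rw [hu, Finset.erase_right_comm, Finset.insert_erase hik']
  have hiu : i ∉ u := by simp [hu]
  have hku : k ∉ u := by simp [hu]
  have hju : j ∉ u := by simp [hu, hjs]
  have hlu : l ∉ u := by simp [hu, hls]
  have hij : i ≠ j := by rintro rfl; exact hjs hi
  have hkl : k ≠ l := by rintro rfl; exact hls hk
  have hil : i ≠ l := by rintro rfl; exact hls hi
  have hjk : j ≠ k := by rintro rfl; exact hjs hk
  have hmain := integral_kernel_mul_le h (u := u) (Finset.card_pos.1 (by omega)) hik hil hjk hjl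
    hiu hju hku hlu (h3 u k hku (by omega)) (h3 u i hiu (by omega))
  rw [hins1, hins2] at hmain
  refine hmain.trans ?_
  have hb := (h4 u (by omega)).2 i j k l hij hkl hik hil hjk hjl hiu hju hku hlu
  rw [mul_div_assoc] at hb
  refine hb.trans (le_of_eq ?_)
  rw [show u.card + 1 = s.card - 1 by omega]

end Kernels

/-! ### The projection of the population kernel -/

section Projection

variable {E ι : Type*} [MeasurableSpace E]

/-- The centred relative deepness `∫ κ(D(x; F), D(y; F)) dF(x)`; in the absence of ties it equals
`R(y; F) - 1/2`. -/
noncomputable def centredRank (D : E → Measure E → ℝ) (F : Measure E) (y : E) : ℝ :=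
  ∫ x, signKernel (D x F) (D y F) ∂F

variable {D : E → Measure E → ℝ} {F : Measure E} {β : ℝ}

theorem measurable_kernel_prod (h : RegularDepth D F β) :
    Measurable fun p : E × E => signKernel (D p.1 F) (D p.2 F) :=
  (h.measurable_pop.comp measurable_fst).signKernel (h.measurable_pop.comp measurable_snd)

theorem integral_kernel_right (x : E) :
    ∫ y, signKernel (D x F) (D y F) ∂F = -centredRank D F x := by
  rw [centredRank, ← integral_neg]
  exact integral_congr_ae (ae_of_all _ fun y => signKernel_swap _ _)

variable [IsProbabilityMeasure F]

theorem measurable_centredRank (h : RegularDepth D F β) : Measurable (centredRank D F) := by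
  have : StronglyMeasurable fun y => ∫ x, signKernel (D x F) (D y F) ∂F :=
    (measurable_kernel_prod h).stronglyMeasurable.integral_prod_left
  exact this.measurable

theorem abs_centredRank_le (y : E) : |centredRank D F y| ≤ 1 / 2 := by
  have := norm_integral_le_of_norm_le_const (μ := F) (f := fun x => signKernel (D x F) (D y F))
    (C := 1 / 2) (ae_of_all _ fun x => abs_signKernel_le (D x F) (D y F))
  simpa [centredRank] using this

theorem integrable_kernel_prod (h : RegularDepth D F β) :
    Integrable (fun p : E × E => signKernel (D p.1 F) (D p.2 F)) (F.prod F) :=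
  integrable_of_abs_le (measurable_kernel_prod h) fun _ => abs_signKernel_le _ _

theorem integral_centredRank (h : RegularDepth D F β) : ∫ y, centredRank D F y ∂F = 0 := by
  have h1 : ∫ y, centredRank D F y ∂F = ∫ x, ∫ y, signKernel (D x F) (D y F) ∂F ∂F :=
    (integral_integral_swap (integrable_kernel_prod h)).symm
  simp_rw [integral_kernel_right] at h1
  rw [integral_neg] at h1
  linarith

/-- The population kernel minus its projection on functions of a single observation. -/
noncomputable def degenerateKernel (D : E → Measure E → ℝ) (F : Measure E) (i j : ι)
    (z : ι → E) : ℝ :=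
  popKernel D F i j z - centredRank D F (z j) + centredRank D F (z i)

theorem measurable_degenerateKernel (h : RegularDepth D F β) (i j : ι) :
    Measurable (degenerateKernel D F i j) :=
  ((measurable_popKernel h i j).sub ((measurable_centredRank h).comp (measurable_pi_apply j))).add
    ((measurable_centredRank h).comp (measurable_pi_apply i))

theorem abs_degenerateKernel_le (i j : ι) (z : ι → E) : |degenerateKernel D F i j z| ≤ 3 / 2 := by
  have h1 := abs_le.1 (abs_signKernel_le (D (z i) F) (D (z j) F))
  have h2 := abs_le.1 (abs_centredRank_le (D := D) (F := F) (z i))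
  have h3 := abs_le.1 (abs_centredRank_le (D := D) (F := F) (z j))
  unfold degenerateKernel popKernel
  rw [abs_le]
  constructor <;> linarith

theorem integral_comp_coord (a : ι) {f : E → ℝ} (hf : Measurable f) :
    ∫ w, f (w a) ∂iidMeasure F ι = ∫ x, f x ∂F := by
  have hp := measurePreserving_eval_infinitePi (fun _ : ι => F) a
  conv_rhs => rw [← hp.map_eq]
  exact (integral_map hp.measurable.aemeasurable hf.aestronglyMeasurable).symm

theorem integrable_degenerateKernel_mul (h : RegularDepth D F β) (i j k l : ι) :
    Integrable (fun z => degenerateKernel D F i j z * degenerateKernel D F k l z)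
      (iidMeasure F ι) := by
  refine integrable_of_abs_le
    ((measurable_degenerateKernel h i j).mul (measurable_degenerateKernel h k l))
    (B := 3 / 2 * (3 / 2)) fun z => ?_
  rw [abs_mul]
  exact mul_le_mul (abs_degenerateKernel_le _ _ _) (abs_degenerateKernel_le _ _ _) (abs_nonneg _)
    (by norm_num)

theorem integral_degenerateKernel_mul_left [DecidableEq ι] (h : RegularDepth D F β) {i j k l : ι}
    (hij : i ≠ j) (hik : i ≠ k) (hil : i ≠ l) :
    ∫ z, degenerateKernel D F i j z * degenerateKernel D F k l z ∂iidMeasure F ι = 0 := by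
  rw [integral_iid_eq_resample F (fun a => a = i)
    (f := fun z => degenerateKernel D F i j z * degenerateKernel D F k l z)
    ((measurable_degenerateKernel h i j).mul (measurable_degenerateKernel h k l))
    (integrable_degenerateKernel_mul h i j k l)]
  refine integral_eq_zero_of_ae (ae_of_all _ fun z => ?_)
  have e : ∀ w, degenerateKernel D F i j (resample (fun a => a = i) z w) *
      degenerateKernel D F k l (resample (fun a => a = i) z w)
      = (fun x => signKernel (D x F) (D (z j) F) - centredRank D F (z j) + centredRank D F x) (w i)
        * degenerateKernel D F k l z := by
    intro w
    simp [degenerateKernel, popKernel, resample, hij.symm, hik.symm, hil.symm]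
  have m1 : Measurable fun x => signKernel (D x F) (D (z j) F) :=
    h.measurable_pop.signKernel measurable_const
  have i1 : Integrable (fun x => signKernel (D x F) (D (z j) F)) F :=
    integrable_of_abs_le m1 fun _ => abs_signKernel_le _ _
  have i2 : Integrable (centredRank D F) F :=
    integrable_of_abs_le (measurable_centredRank h) abs_centredRank_le
  have i3 : Integrable (fun x => signKernel (D x F) (D (z j) F) - centredRank D F (z j)) F :=
    i1.sub (integrable_const _)
  have m3 : Measurable fun x => signKernel (D x F) (D (z j) F) - centredRank D F (z j)
      + centredRank D F x := (m1.sub_const _).add (measurable_centredRank h)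
  have e2 := integral_comp_coord (F := F) i m3
  simp only [Pi.zero_apply]
  simp_rw [e]
  rw [integral_mul_const, e2, integral_add i3 i2, integral_sub i1 (integrable_const _),
    integral_centredRank h]
  simp [centredRank]

theorem integral_degenerateKernel_mul_right [DecidableEq ι] (h : RegularDepth D F β) {i j k l : ι}
    (hij : i ≠ j) (hjk : j ≠ k) (hjl : j ≠ l) :
    ∫ z, degenerateKernel D F i j z * degenerateKernel D F k l z ∂iidMeasure F ι = 0 := by
  have hsymm : ∀ (a b : ι) (z : ι → E), degenerateKernel D F a b z = -degenerateKernel D F b a z := by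
    intro a b z
    simp only [degenerateKernel, popKernel]
    rw [signKernel_swap]
    ring
  simp_rw [hsymm i j, neg_mul]
  rw [integral_neg, integral_degenerateKernel_mul_left h hij.symm hjk hjl, neg_zero]

/-- Distinct entries of the degenerate array are uncorrelated. -/
theorem integral_avg_degenerateKernel_sq_le [DecidableEq ι] (h : RegularDepth D F β)
    {s t : Finset ι} (hst : Disjoint s t) (hs : s.Nonempty) (ht : t.Nonempty) :
    ∫ z, (doubleAvg s t fun i j => degenerateKernel D F i j z) ^ 2 ∂iidMeasure F ι
      ≤ (s.card : ℝ)⁻¹ * (t.card : ℝ)⁻¹ * (9 / 4) := by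
  have := integral_doubleAvg_sq_le (μ := iidMeasure F ι) hs ht
    (V := fun i j => degenerateKernel D F i j) (B := 3 / 2)
    (fun i _ j _ => measurable_degenerateKernel h i j) abs_degenerateKernel_le
    (ε := 0) (η := 0) (ζ := 9 / 4) ?_
  · simpa using this
  intro i hi j hj k hk l hl
  have hij : i ≠ j := by rintro rfl; exact Finset.disjoint_left.1 hst hi hj
  have hil : i ≠ l := by rintro rfl; exact Finset.disjoint_left.1 hst hi hl
  have hjk : j ≠ k := by rintro rfl; exact Finset.disjoint_left.1 hst hk hj
  simp only [ite_self, add_zero, zero_add]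
  by_cases hik : i = k
  · by_cases hjl : j = l
    · rw [if_pos ⟨hik, hjl⟩]
      have hb := norm_integral_le_of_norm_le_const (μ := iidMeasure F ι) (C := 9 / 4)
        (f := fun z => degenerateKernel D F i j z * degenerateKernel D F k l z)
        (ae_of_all _ fun z => by
          rw [Real.norm_eq_abs, abs_mul]
          refine (mul_le_mul (abs_degenerateKernel_le _ _ _) (abs_degenerateKernel_le _ _ _)
            (abs_nonneg _) (by norm_num)).trans (by norm_num))
      simp only [probReal_univ, mul_one] at hb
      exact (le_abs_self _).trans hb
    · rw [integral_degenerateKernel_mul_right h hij hjk hjl, if_neg (by tauto)]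
  · rw [integral_degenerateKernel_mul_left h hij hik hil, if_neg (by tauto)]

/-- The population depths of independent observations are almost surely distinct. -/
theorem ae_depth_ne (h : RegularDepth D F β) {i j : ι} (hij : i ≠ j) :
    ∀ᵐ z ∂iidMeasure F ι, D (z i) F ≠ D (z j) F := by
  have hβ : 0 < β := by linarith [h.half_lt]
  obtain ⟨C, -, hC⟩ := h.condA1.near_le hβ (fun x => (h.mem_Icc x F).1) h.measurable_pop
  have h0 := hC 0 le_rfl
  rw [Real.zero_rpow hβ.ne', mul_zero, ENNReal.ofReal_zero, nonpos_iff_eq_zero] at h0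
  have hp := measurePreserving_pair F (ι := ι) hij
  rw [← hp.map_eq] at h0
  have h1 : ∀ᵐ p ∂Measure.map (fun z : ι → E => (z i, z j)) (iidMeasure F ι),
      ¬ |D p.1 F - D p.2 F| ≤ 0 := by
    rw [ae_iff]
    simpa using h0
  filter_upwards [ae_of_ae_map hp.measurable.aemeasurable h1] with z hz hne
  exact hz (by simp [hne])

theorem integral_popKernel_mul_popKernel [DecidableEq ι] (h : RegularDepth D F β) {a b c : ι}
    (hab : a ≠ b) (hac : a ≠ c) (hbc : b ≠ c) :
    ∫ z, popKernel D F b a z * popKernel D F c a z ∂iidMeasure F ι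
      = ∫ y, centredRank D F y ^ 2 ∂F := by
  have mr := measurable_centredRank h
  have m1 : Measurable fun z : ι → E => popKernel D F b a z * popKernel D F c a z :=
    (measurable_popKernel h b a).mul (measurable_popKernel h c a)
  have m2 : Measurable fun z : ι → E => centredRank D F (z a) * popKernel D F c a z :=
    (mr.comp (measurable_pi_apply a)).mul (measurable_popKernel h c a)
  have hk : ∀ i j (z : ι → E), |popKernel D F i j z| ≤ 1 / 2 := fun i j z => abs_signKernel_le _ _
  rw [integral_iid_eq_resample F (fun i => i = b) m1 (integrable_of_abs_le m1 (B := 1 / 2 * (1 / 2))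
    fun z => by
      rw [abs_mul]; exact mul_le_mul (hk _ _ _) (hk _ _ _) (abs_nonneg _) (by norm_num))]
  have e1 : ∀ z : ι → E, ∫ w, popKernel D F b a (resample (fun i => i = b) z w) *
      popKernel D F c a (resample (fun i => i = b) z w) ∂iidMeasure F ι
      = centredRank D F (z a) * popKernel D F c a z := by
    intro z
    have : ∀ w : ι → E, popKernel D F b a (resample (fun i => i = b) z w) *
      popKernel D F c a (resample (fun i => i = b) z w)
      = (fun x => signKernel (D x F) (D (z a) F)) (w b) * popKernel D F c a z := by
      intro w
      simp [popKernel, resample, hab, hbc.symm]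
    simp_rw [this]
    rw [integral_mul_const, integral_comp_coord b
      (h.measurable_pop.signKernel measurable_const)]
    rfl
  simp_rw [e1]
  rw [integral_iid_eq_resample F (fun i => i = c) m2 (integrable_of_abs_le m2 (B := 1 / 2 * (1 / 2))
    fun z => by
      rw [abs_mul]
      exact mul_le_mul (abs_centredRank_le _) (hk _ _ _) (abs_nonneg _) (by norm_num))]
  have e2 : ∀ z : ι → E, ∫ w, centredRank D F (resample (fun i => i = c) z w a) *
      popKernel D F c a (resample (fun i => i = c) z w) ∂iidMeasure F ι
      = centredRank D F (z a) ^ 2 := by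
    intro z
    have : ∀ w : ι → E, centredRank D F (resample (fun i => i = c) z w a) *
      popKernel D F c a (resample (fun i => i = c) z w)
      = centredRank D F (z a) * (fun x => signKernel (D x F) (D (z a) F)) (w c) := by
      intro w
      simp [popKernel, resample, hac]
    simp_rw [this]
    rw [integral_const_mul, integral_comp_coord c
      (h.measurable_pop.signKernel measurable_const), sq]
    rfl
  simp_rw [e2]
  exact integral_comp_coord a (mr.pow_const 2)

/-- The variance `1/12` of the relative deepness comes from exchangeability of three observations,
whose depths are almost surely distinct. -/
theorem integral_centredRank_sq (h : RegularDepth D F β) :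
    ∫ y, centredRank D F y ^ 2 ∂F = 1 / 12 := by
  have hk : ∀ (i j : Fin 3) (z : Fin 3 → E), |popKernel D F i j z| ≤ 1 / 2 :=
    fun i j z => abs_signKernel_le _ _
  have hi : ∀ a b c d : Fin 3, Integrable (fun z => popKernel D F a b z * popKernel D F c d z)
      (iidMeasure F (Fin 3)) := fun a b c d =>
    integrable_of_abs_le ((measurable_popKernel h a b).mul (measurable_popKernel h c d))
      (B := 1 / 2 * (1 / 2)) fun z => by
        rw [abs_mul]; exact mul_le_mul (hk _ _ _) (hk _ _ _) (abs_nonneg _) (by norm_num)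
  have e0 := integral_popKernel_mul_popKernel h (a := (0 : Fin 3)) (b := 1) (c := 2)
    (by decide) (by decide) (by decide)
  have e1 := integral_popKernel_mul_popKernel h (a := (1 : Fin 3)) (b := 0) (c := 2)
    (by decide) (by decide) (by decide)
  have e2 := integral_popKernel_mul_popKernel h (a := (2 : Fin 3)) (b := 0) (c := 1)
    (by decide) (by decide) (by decide)
  have hsum : ∫ z, (popKernel D F 1 0 z * popKernel D F 2 0 z
      + popKernel D F 0 1 z * popKernel D F 2 1 z
      + popKernel D F 0 2 z * popKernel D F 1 2 z) ∂iidMeasure F (Fin 3) = 1 / 4 := by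
    have hae : ∀ᵐ z ∂iidMeasure F (Fin 3), popKernel D F 1 0 z * popKernel D F 2 0 z
        + popKernel D F 0 1 z * popKernel D F 2 1 z
        + popKernel D F 0 2 z * popKernel D F 1 2 z = 1 / 4 := by
      filter_upwards [ae_depth_ne h (show (0 : Fin 3) ≠ 1 by decide),
        ae_depth_ne h (show (0 : Fin 3) ≠ 2 by decide),
        ae_depth_ne h (show (1 : Fin 3) ≠ 2 by decide)] with z h01 h02 h12
      exact signKernel_cyclic h01 h02 h12
    rw [integral_congr_ae hae]
    simp
  have i12 : Integrable (fun z => popKernel D F 1 0 z * popKernel D F 2 0 z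
      + popKernel D F 0 1 z * popKernel D F 2 1 z) (iidMeasure F (Fin 3)) :=
    (hi 1 0 2 0).add (hi 0 1 2 1)
  rw [integral_add i12 (hi 0 2 1 2), integral_add (hi 1 0 2 0) (hi 0 1 2 1), e0, e1, e2] at hsum
  linarith

end Projection

/-! ### Linearization of the quality index -/

section Expansion

variable {E ι : Type*} [MeasurableSpace E] {D : E → Measure E → ℝ} {F : Measure E} {β : ℝ}

/-- The linear part of the quality index: the difference of the average centred ranks of the
samples `t` and `s`. -/
noncomputable def rankDiff (D : E → Measure E → ℝ) (F : Measure E) (s t : Finset ι)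
    (z : ι → E) : ℝ :=
  (t.card : ℝ)⁻¹ * ∑ j ∈ t, centredRank D F (z j) - (s.card : ℝ)⁻¹ * ∑ i ∈ s, centredRank D F (z i)

theorem rankDiff_swap (s t : Finset ι) (z : ι → E) :
    rankDiff D F t s z = -rankDiff D F s t z := by
  simp [rankDiff]

theorem measurable_rankDiff [IsProbabilityMeasure F] (h : RegularDepth D F β) (s t : Finset ι) :
    Measurable (rankDiff D F s t) := by
  have := measurable_centredRank h
  unfold rankDiff
  fun_prop

theorem integral_abs_le_sqrt_integral_sq {α : Type*} [MeasurableSpace α] {μ : Measure α}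
    [IsProbabilityMeasure μ] {f : α → ℝ} (hf : MemLp f 2 μ) :
    ∫ a, |f a| ∂μ ≤ √(∫ a, f a ^ 2 ∂μ) := by
  refine Real.le_sqrt_of_sq_le ?_
  have h1 := variance_nonneg |f| μ
  rw [variance_eq_sub hf.abs] at h1
  simp only [Pi.pow_apply, Pi.abs_apply, sq_abs] at h1
  linarith

variable [MeasurableSingletonClass E]

theorem qualityIndex_empOn (D : E → Measure E → ℝ) (s t : Finset ι) (z : ι → E) :
    qualityIndex D (empOn z s) (empOn z t) =
      doubleAvg s t fun i j => if D (z i) (empOn z s) ≤ D (z j) (empOn z s) then 1 else 0 := by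
  obtain ⟨e, he⟩ := exists_enum s rfl
  obtain ⟨f, hf⟩ := exists_enum t rfl
  have hs : ∀ g : ι → ℝ, ∑ i ∈ s, g i = ∑ a, g (e a) := fun g => by
    conv_lhs => rw [← he]
    rw [Finset.sum_map]
  have ht : ∀ g : ι → ℝ, ∑ i ∈ t, g i = ∑ a, g (f a) := fun g => by
    conv_lhs => rw [← hf]
    rw [Finset.sum_map]
  have hes : empOn z s = empiricalMeasure fun a => z (e a) := by
    conv_lhs => rw [← he]
    exact empOn_map z e
  have het : empOn z t = empiricalMeasure fun a => z (f a) := by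
    conv_lhs => rw [← hf]
    exact empOn_map z f
  rw [doubleAvg, Finset.sum_comm, ht]
  simp_rw [hs]
  rw [hes, het, qualityIndex_empirical, ← Finset.mul_sum, ← mul_assoc, mul_comm (t.card : ℝ)⁻¹]
  simp only [Set.indicator_apply, Set.mem_ofPred_eq]

theorem qualityIndex_decomposition [DecidableEq ι] {s t : Finset ι} (hs : s.Nonempty)
    (ht : t.Nonempty) (z : ι → E) :
    qualityIndex D (empOn z s) (empOn z t) - 1 / 2 - rankDiff D F s t z =
      (doubleAvg s t fun i j =>
          ((if D (z i) (empOn z s) ≤ D (z j) (empOn z s) then 1 else 0) - 1 / 2)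
            - sampleKernel D (s.erase i) i j z)
      + (doubleAvg s t fun i j => sampleKernel D (s.erase i) i j z - popKernel D F i j z)
      + doubleAvg s t fun i j => degenerateKernel D F i j z := by
  have hm : (s.card : ℝ) ≠ 0 := by simpa using hs.ne_empty
  have hn : (t.card : ℝ) ≠ 0 := by simpa using ht.ne_empty
  rw [qualityIndex_empOn]
  simp only [doubleAvg, degenerateKernel, rankDiff, Finset.sum_sub_distrib, Finset.sum_add_distrib,
    Finset.sum_const, nsmul_eq_mul, ← Finset.mul_sum]
  field_simp
  ring

theorem measurable_qualityIndex_empOn (h : RegularDepth D F β) (s t : Finset ι) :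
    Measurable fun z : ι → E => qualityIndex D (empOn z s) (empOn z t) := by
  simp_rw [qualityIndex_empOn]
  -- measurability of the depth is only known for nonempty samples; for `s = ∅` the sum is empty
  rcases s.eq_empty_or_nonempty with rfl | hs
  · simp [doubleAvg]
  exact Measurable.doubleAvg fun i _ j _ => Measurable.ite
    (measurableSet_le (measurable_depth_empOn h.measurable_emp hs i)
      (measurable_depth_empOn h.measurable_emp hs j)) measurable_const measurable_const

/-- The linear part of the quality index is within `o(√(1/m + 1/n))` of it in mean. -/
theorem exists_bound_qualityIndex_sub_rankDiff [DecidableEq ι] [IsProbabilityMeasure F]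
    (h : RegularDepth D F β) :
    ∃ (b : ℕ → ℝ) (N : ℕ), Tendsto b atTop (𝓝 0) ∧ ∀ s t : Finset ι, Disjoint s t →
      N ≤ s.card → t.Nonempty →
      Integrable (fun z => qualityIndex D (empOn z s) (empOn z t) - 1 / 2 - rankDiff D F s t z)
        (iidMeasure F ι) ∧
      √((s.card : ℝ) * t.card / (s.card + t.card)) *
        ∫ z, |qualityIndex D (empOn z s) (empOn z t) - 1 / 2 - rankDiff D F s t z| ∂iidMeasure F ι
          ≤ b s.card := by
  have hβ := h.half_lt
  obtain ⟨K₁, N₁, hK₁, h₁⟩ := integral_abs_avg_indicator_sub_le (ι := ι) h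
  obtain ⟨K₂, L, N₂, h₂⟩ := integral_avg_kernel_sub_sq_le (ι := ι) h
  refine ⟨fun m => K₁ * (m : ℝ) ^ (-(β - 1 / 2))
      + √(2 * K₂ ^ 2 * ((m - 1 : ℕ) : ℝ) ^ (-(2 * β - 1)) + L * ((m - 1 : ℕ) : ℝ) ^ (-(β / 2)))
      + √(9 / 4 * (m : ℝ)⁻¹), max N₁ N₂ + 2, ?_, fun s t hst hN ht => ?_⟩
  · have c1 : Tendsto (fun m : ℕ => (m : ℝ)) atTop atTop := tendsto_natCast_atTop_atTop
    have c2 : Tendsto (fun m : ℕ => ((m - 1 : ℕ) : ℝ)) atTop atTop :=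
      c1.comp (tendsto_sub_atTop_nat 1)
    have l1 := ((tendsto_rpow_neg_atTop (show 0 < β - 1 / 2 by linarith)).comp c1).const_mul K₁
    have l2 := ((tendsto_rpow_neg_atTop (show 0 < 2 * β - 1 by linarith)).comp c2).const_mul
      (2 * K₂ ^ 2)
    have l3 := ((tendsto_rpow_neg_atTop (show 0 < β / 2 by linarith)).comp c2).const_mul L
    have l4 := (tendsto_inv_atTop_zero.comp c1).const_mul (9 / 4)
    have := (l1.add (l2.add l3).sqrt).add l4.sqrt
    simpa using this
  have hs : s.Nonempty := Finset.card_pos.1 (by omega)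
  have hne : ∀ i ∈ s, (s.erase i).Nonempty := fun i hi =>
    Finset.card_pos.1 (by rw [Finset.card_erase_of_mem hi]; omega)
  have hm : (0 : ℝ) < s.card := by exact_mod_cast hs.card_pos
  have hn : (0 : ℝ) < t.card := by exact_mod_cast ht.card_pos
  let A : (ι → E) → ℝ := fun z => doubleAvg s t fun i j =>
    ((if D (z i) (empOn z s) ≤ D (z j) (empOn z s) then 1 else 0) - 1 / 2)
      - sampleKernel D (s.erase i) i j z
  let B : (ι → E) → ℝ := fun z => doubleAvg s t fun i j =>
    sampleKernel D (s.erase i) i j z - popKernel D F i j z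
  let R : (ι → E) → ℝ := fun z => doubleAvg s t fun i j => degenerateKernel D F i j z
  have mA : Measurable A := Measurable.doubleAvg (V := fun i j (z : ι → E) =>
      ((if D (z i) (empOn z s) ≤ D (z j) (empOn z s) then (1 : ℝ) else 0) - 1 / 2)
        - sampleKernel D (s.erase i) i j z) fun i hi j _ =>
    ((Measurable.ite (measurableSet_le (measurable_depth_empOn h.measurable_emp hs i)
      (measurable_depth_empOn h.measurable_emp hs j)) measurable_const
        measurable_const).sub_const _).sub (measurable_sampleKernel h (hne i hi) i j)
  have mB : Measurable B := Measurable.doubleAvg (V := fun i j (z : ι → E) =>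
      sampleKernel D (s.erase i) i j z - popKernel D F i j z) fun i hi j _ =>
    (measurable_sampleKernel h (hne i hi) i j).sub (measurable_popKernel h i j)
  have mR : Measurable R := Measurable.doubleAvg (V := fun i j (z : ι → E) =>
      degenerateKernel D F i j z) fun i _ j _ => measurable_degenerateKernel h i j
  have bA : ∀ z, |A z| ≤ 1 := fun z => abs_doubleAvg_le zero_le_one fun i _ j _ => by
    refine (abs_sub _ _).trans ((add_le_add ?_ (abs_signKernel_le _ _)).trans
      (le_of_eq (add_halves 1)))
    split_ifs <;> norm_num [abs_of_pos, abs_of_neg]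
  have bB : ∀ z, |B z| ≤ 1 := fun z => abs_doubleAvg_le zero_le_one fun i _ j _ =>
    abs_sampleKernel_sub_popKernel_le _ _ _ _
  have bR : ∀ z, |R z| ≤ 3 / 2 := fun z => abs_doubleAvg_le (by norm_num) fun i _ j _ =>
    abs_degenerateKernel_le _ _ _
  have iA : Integrable A (iidMeasure F ι) := integrable_of_abs_le mA bA
  have iB : Integrable B (iidMeasure F ι) := integrable_of_abs_le mB bB
  have iR : Integrable R (iidMeasure F ι) := integrable_of_abs_le mR bR
  have hdec : ∀ z, qualityIndex D (empOn z s) (empOn z t) - 1 / 2 - rankDiff D F s t z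
      = A z + B z + R z := fun z => qualityIndex_decomposition hs ht z
  simp_rw [hdec]
  have iAB : Integrable (fun z => A z + B z) (iidMeasure F ι) := iA.add iB
  refine ⟨iAB.add iR, ?_⟩
  -- the square of the scaling factor: `w ≤ m`, `w (1/m + 1/n) = 1` and `w / (mn) ≤ 1/m`
  set w : ℝ := (s.card : ℝ) * t.card / (s.card + t.card) with hw
  have hw0 : 0 ≤ w := by positivity
  have hwm : w ≤ s.card := by
    rw [hw, div_le_iff₀ (by positivity)]
    nlinarith
  have hwinv : w * ((s.card : ℝ)⁻¹ + (t.card : ℝ)⁻¹) = 1 := by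
    rw [hw]; field_simp; ring
  have hwmn : w * ((s.card : ℝ)⁻¹ * (t.card : ℝ)⁻¹) ≤ (s.card : ℝ)⁻¹ := by
    rw [← mul_assoc, hw]
    rw [show (s.card : ℝ) * t.card / (s.card + t.card) * (s.card : ℝ)⁻¹ * (t.card : ℝ)⁻¹
      = ((s.card : ℝ) + t.card)⁻¹ by field_simp]
    gcongr
    linarith
  have hL2 : ∀ {f : (ι → E) → ℝ} {b : ℝ}, Measurable f → (∀ z, |f z| ≤ b) →
      √w * ∫ z, |f z| ∂iidMeasure F ι ≤ √(w * ∫ z, f z ^ 2 ∂iidMeasure F ι) := by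
    intro f b hf hb
    rw [Real.sqrt_mul hw0]
    gcongr
    exact integral_abs_le_sqrt_integral_sq (MemLp.of_bound hf.aestronglyMeasurable b
      (ae_of_all _ hb))
  have hA : √w * ∫ z, |A z| ∂iidMeasure F ι ≤ K₁ * (s.card : ℝ) ^ (-(β - 1 / 2)) := by
    calc √w * ∫ z, |A z| ∂iidMeasure F ι ≤ √(s.card : ℝ) * (K₁ * (s.card : ℝ) ^ (-β)) :=
          mul_le_mul (Real.sqrt_le_sqrt hwm) (h₁ s t hst (by omega))
            (integral_nonneg fun z => abs_nonneg _) (Real.sqrt_nonneg _)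
      _ = K₁ * (s.card : ℝ) ^ (-(β - 1 / 2)) := by
          rw [Real.sqrt_eq_rpow, mul_left_comm, ← Real.rpow_add hm]
          congr 2
          ring
  have hB : √w * ∫ z, |B z| ∂iidMeasure F ι ≤
      √(2 * K₂ ^ 2 * ((s.card - 1 : ℕ) : ℝ) ^ (-(2 * β - 1))
        + L * ((s.card - 1 : ℕ) : ℝ) ^ (-(β / 2))) := by
    refine (hL2 mB bB).trans (Real.sqrt_le_sqrt ?_)
    refine (mul_le_mul_of_nonneg_left (h₂ s t hst (by omega) ht) hw0).trans ?_
    rw [mul_add, ← mul_assoc w (_ + _), hwinv, one_mul]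
    gcongr ?_ + _
    have hm1 : (0 : ℝ) < ((s.card - 1 : ℕ) : ℝ) := by
      exact_mod_cast (show 0 < s.card - 1 by omega)
    -- leave-two-out near ties are at scale `m - 1`, which is at least `m / 2`
    have hw2 : w ≤ 2 * ((s.card - 1 : ℕ) : ℝ) := by
      refine hwm.trans ?_
      exact_mod_cast (show s.card ≤ 2 * (s.card - 1) by omega)
    calc w * (K₂ ^ 2 * ((s.card - 1 : ℕ) : ℝ) ^ (-(2 * β)))
        ≤ 2 * ((s.card - 1 : ℕ) : ℝ) * (K₂ ^ 2 * ((s.card - 1 : ℕ) : ℝ) ^ (-(2 * β))) := by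
          gcongr
      _ = 2 * K₂ ^ 2 * (((s.card - 1 : ℕ) : ℝ) ^ (1 : ℝ)
            * ((s.card - 1 : ℕ) : ℝ) ^ (-(2 * β))) := by
          rw [Real.rpow_one]; ring
      _ = 2 * K₂ ^ 2 * ((s.card - 1 : ℕ) : ℝ) ^ (-(2 * β - 1)) := by
          rw [← Real.rpow_add hm1]
          congr 2
          ring
  have hR : √w * ∫ z, |R z| ∂iidMeasure F ι ≤ √(9 / 4 * (s.card : ℝ)⁻¹) := by
    refine (hL2 mR bR).trans (Real.sqrt_le_sqrt ?_)
    refine (mul_le_mul_of_nonneg_left (integral_avg_degenerateKernel_sq_le h hst hs ht) hw0).trans ?_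
    rw [← mul_assoc, mul_comm (9 / 4 : ℝ)]
    gcongr
  calc √w * ∫ z, |A z + B z + R z| ∂iidMeasure F ι
      ≤ √w * ∫ z, (|A z| + |B z| + |R z|) ∂iidMeasure F ι := by
        refine mul_le_mul_of_nonneg_left (integral_mono (iAB.add iR).abs
          ((iA.abs.add iB.abs).add iR.abs) fun z => abs_add_three _ _ _) (Real.sqrt_nonneg _)
    _ = √w * ∫ z, |A z| ∂iidMeasure F ι + √w * ∫ z, |B z| ∂iidMeasure F ι
          + √w * ∫ z, |R z| ∂iidMeasure F ι := by
        have iABabs : Integrable (fun z => |A z| + |B z|) (iidMeasure F ι) := iA.abs.add iB.abs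
        rw [integral_add iABabs iR.abs, integral_add iA.abs iB.abs]
        ring
    _ ≤ _ := add_le_add (add_le_add hA hB) hR

end Expansion

/-! ### Convergence in distribution -/

section Distribution

variable {Ω Ω' : Type*} [MeasurableSpace Ω] [MeasurableSpace Ω'] {P : Measure Ω}
  [IsProbabilityMeasure P] {P' : Measure Ω'} [IsProbabilityMeasure P']

theorem MeasureTheory.TendstoInDistribution.comp_tendsto {S : ℕ → Ω → ℝ} {U : Ω' → ℝ}
    (h : TendstoInDistribution S atTop U (fun _ => P) P') {m : ℕ → ℕ}
    (hm : Tendsto m atTop atTop) :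
    TendstoInDistribution (fun k => S (m k)) atTop U (fun _ => P) P' :=
  ⟨fun k => h.forall_aemeasurable (m k), h.aemeasurable_limit, h.tendsto.comp hm⟩

/-- Convergence in distribution only depends on the law of the underlying random element. -/
theorem MeasureTheory.TendstoInDistribution.comp_hasLaw {𝒳 : Type*} [MeasurableSpace 𝒳] {γ : Measure 𝒳}
    [IsProbabilityMeasure γ] {S : ℕ → 𝒳 → ℝ} {U : Ω' → ℝ} {Z : Ω → 𝒳} (hZ : HasLaw Z γ P)
    (h : TendstoInDistribution S atTop U (fun _ => γ) P') :
    TendstoInDistribution (fun k ω => S k (Z ω)) atTop U (fun _ => P) P' := by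
  have hS : ∀ k, AEMeasurable (S k) (P.map Z) := fun k => by
    rw [hZ.map_eq]; exact h.forall_aemeasurable k
  refine ⟨fun k => (hS k).comp_aemeasurable hZ.aemeasurable, h.aemeasurable_limit, ?_⟩
  refine h.tendsto.congr fun k => Subtype.ext ?_
  have := AEMeasurable.map_map_of_aemeasurable (hS k) hZ.aemeasurable
  rw [hZ.map_eq] at this
  exact this

/-- Convergence in distribution only depends on the law of the limit. -/
theorem MeasureTheory.TendstoInDistribution.of_map_eq {Ω'' : Type*} [MeasurableSpace Ω''] {P'' : Measure Ω''}
    [IsProbabilityMeasure P''] {S : ℕ → Ω → ℝ} {U : Ω' → ℝ} {V : Ω'' → ℝ}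
    (h : TendstoInDistribution S atTop U (fun _ => P) P') (hV : AEMeasurable V P'')
    (hUV : P'.map U = P''.map V) : TendstoInDistribution S atTop V (fun _ => P) P'' := by
  have e : (⟨P'.map U, Measure.isProbabilityMeasure_map h.aemeasurable_limit⟩ :
      ProbabilityMeasure ℝ) = ⟨P''.map V, Measure.isProbabilityMeasure_map hV⟩ := Subtype.ext hUV
  exact ⟨h.forall_aemeasurable, hV, e ▸ h.tendsto⟩

theorem MeasureTheory.TendstoInDistribution.const_mul_of_tendsto {S : ℕ → Ω → ℝ} {U : Ω' → ℝ}
    (h : TendstoInDistribution S atTop U (fun _ => P) P') {a : ℕ → ℝ} {b : ℝ}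
    (ha : Tendsto a atTop (𝓝 b)) :
    TendstoInDistribution (fun k ω => a k * S k ω) atTop (fun ω => b * U ω) (fun _ => P) P' := by
  refine h.continuous_comp_prodMk_of_tendstoInMeasure_const (g := fun p : ℝ × ℝ => p.2 * p.1)
    (Y := fun k _ => a k) (c := b) (by fun_prop) ?_ (fun _ => aemeasurable_const)
  exact tendstoInMeasure_of_tendsto_ae (fun _ => aestronglyMeasurable_const) (ae_of_all _ fun _ => ha)

/-- Sums of independent asymptotically normal sequences are asymptotically normal, by Lévy's
continuity theorem. -/
theorem tendstoInDistribution_add_gaussian {A B : ℕ → Ω → ℝ} {a b : ℝ} (hab : a ^ 2 + b ^ 2 = 1)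
    (hA : TendstoInDistribution A atTop (fun x => a * x) (fun _ => P) (gaussianReal 0 1))
    (hB : TendstoInDistribution B atTop (fun x => b * x) (fun _ => P) (gaussianReal 0 1))
    (hind : ∀ k, IndepFun (A k) (B k) P) :
    TendstoInDistribution (fun k ω => A k ω + B k ω) atTop (fun x => x) (fun _ => P)
      (gaussianReal 0 1) := by
  refine ⟨fun k => (hA.forall_aemeasurable k).add (hB.forall_aemeasurable k), by fun_prop, ?_⟩
  refine ProbabilityMeasure.tendsto_iff_tendsto_charFun.2 fun t => ?_
  have h1 := ProbabilityMeasure.tendsto_iff_tendsto_charFun.1 hA.tendsto t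
  have h2 := ProbabilityMeasure.tendsto_iff_tendsto_charFun.1 hB.tendsto t
  simp only [ProbabilityMeasure.coe_mk] at h1 h2 ⊢
  have h3 := h1.mul h2
  rw [charFun_map_mul, charFun_map_mul, charFun_gaussianReal, charFun_gaussianReal,
    ← Complex.exp_add] at h3
  rw [Measure.map_id', charFun_gaussianReal]
  convert h3 using 2 with k
  · rw [(hind k).charFun_map_fun_add_eq_mul (hA.forall_aemeasurable k) (hB.forall_aemeasurable k)]
    rfl
  · congr 1
    have : ((a : ℂ)) ^ 2 + (b : ℂ) ^ 2 = 1 := by exact_mod_cast hab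
    push_cast
    linear_combination (-(t : ℂ) ^ 2 / 2) * -this

end Distribution

/-! ### Two samples from one law -/

section TwoSample

variable {E : Type*} [MeasurableSpace E] {D : E → Measure E → ℝ} {F : Measure E}
  [IsProbabilityMeasure F] {β : ℝ}

/-- The indices of the first `m` observations of the first sample. -/
def leftIndex (m : ℕ) : Finset (ℕ ⊕ ℕ) :=
  Finset.univ.map ((Fin.valEmbedding (n := m)).trans Function.Embedding.inl)

/-- The indices of the first `n` observations of the second sample. -/
def rightIndex (n : ℕ) : Finset (ℕ ⊕ ℕ) :=
  Finset.univ.map ((Fin.valEmbedding (n := n)).trans Function.Embedding.inr)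

theorem card_leftIndex (m : ℕ) : (leftIndex m).card = m := by simp [leftIndex]

theorem card_rightIndex (n : ℕ) : (rightIndex n).card = n := by simp [rightIndex]

theorem disjoint_leftIndex_rightIndex (m n : ℕ) : Disjoint (leftIndex m) (rightIndex n) := by
  simp [Finset.disjoint_left, leftIndex, rightIndex]

theorem sum_leftIndex (m : ℕ) (f : ℕ ⊕ ℕ → ℝ) :
    ∑ a ∈ leftIndex m, f a = ∑ i ∈ Finset.range m, f (Sum.inl i) := by
  rw [leftIndex, Finset.sum_map, Finset.sum_range]
  rfl

theorem sum_rightIndex (n : ℕ) (f : ℕ ⊕ ℕ → ℝ) :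
    ∑ a ∈ rightIndex n, f a = ∑ i ∈ Finset.range n, f (Sum.inr i) := by
  rw [rightIndex, Finset.sum_map, Finset.sum_range]
  rfl

/-- The central limit theorem for the centred ranks along any sequence of distinct observations;
the factor `√12` normalizes their variance. -/
theorem tendstoInDistribution_sum_centredRank {ι : Type*} (h : RegularDepth D F β) {f : ℕ → ι}
    (hf : Function.Injective f) :
    TendstoInDistribution
      (fun (n : ℕ) (z : ι → E) => (√n)⁻¹ * ∑ i ∈ Finset.range n, √12 * centredRank D F (z (f i)))
      atTop (fun x => x) (fun _ => iidMeasure F ι) (gaussianReal 0 1) := by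
  have mr : Measurable fun x => √12 * centredRank D F x := (measurable_centredRank h).const_mul _
  have hind : iIndepFun (fun i (z : ι → E) => √12 * centredRank D F (z (f i))) (iidMeasure F ι) :=
    (iIndepFun_infinitePi (P := fun _ : ι => F)
      (X := fun _ x => √12 * centredRank D F x) fun _ => mr).precomp hf
  have hlaw : ∀ i, Measure.map (fun z : ι → E => √12 * centredRank D F (z (f i))) (iidMeasure F ι)
      = F.map fun x => √12 * centredRank D F x := fun i => by
    have hp := measurePreserving_eval_infinitePi (fun _ : ι => F) (f i)
    exact (Measure.map_map mr hp.measurable).symm.trans (congrArg (Measure.map _) hp.map_eq)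
  refine tendstoInDistribution_inv_sqrt_mul_sum
    (X := fun i (z : ι → E) => √12 * centredRank D F (z (f i))) ⟨by fun_prop, Measure.map_id'⟩
    ?_ ?_ hind fun i => ⟨?_, ?_, (hlaw i).trans (hlaw 0).symm⟩
  · rw [integral_comp_coord (f 0) mr, integral_const_mul, integral_centredRank h, mul_zero]
  · simp only [Pi.pow_apply, mul_pow]
    rw [integral_comp_coord (f := fun x => √12 ^ 2 * centredRank D F x ^ 2) (f 0)
      (((measurable_centredRank h).pow_const 2).const_mul _), integral_const_mul,
      integral_centredRank_sq h, Real.sq_sqrt (by norm_num)]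
    norm_num
  · exact (mr.comp (measurable_pi_apply _)).aemeasurable
  · exact (mr.comp (measurable_pi_apply _)).aemeasurable

/-- The linear part of the quality index is asymptotically normal: the two samples are independent,
with asymptotic shares `1 - τ` and `τ` of the variance. -/
theorem tendstoInDistribution_rankDiff (h : RegularDepth D F β) {m n : ℕ → ℕ}
    (hm : Tendsto m atTop atTop) (hn : Tendsto n atTop atTop) {τ : ℝ} (hτ0 : 0 < τ) (hτ1 : τ < 1)
    (hτ : Tendsto (fun k => (m k : ℝ) / ((m k : ℝ) + (n k : ℝ))) atTop (𝓝 τ)) :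
    TendstoInDistribution
      (fun (k : ℕ) (z : ℕ ⊕ ℕ → E) => √(12 * m k * n k / (m k + n k)) *
        rankDiff D F (leftIndex (m k)) (rightIndex (n k)) z)
      atTop (fun x => x) (fun _ => iidMeasure F (ℕ ⊕ ℕ)) (gaussianReal 0 1) := by
  have hS := (tendstoInDistribution_sum_centredRank (ι := ℕ ⊕ ℕ) h Sum.inl_injective).comp_tendsto hm
  have hT := (tendstoInDistribution_sum_centredRank (ι := ℕ ⊕ ℕ) h Sum.inr_injective).comp_tendsto hn
  have ha : Tendsto (fun k => -√(1 - (m k : ℝ) / ((m k : ℝ) + (n k : ℝ)))) atTop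
      (𝓝 (-√(1 - τ))) := (hτ.const_sub 1).sqrt.neg
  have hA := hS.const_mul_of_tendsto ha
  have hB := hT.const_mul_of_tendsto hτ.sqrt
  have hadd := tendstoInDistribution_add_gaussian (by
    rw [neg_sq, Real.sq_sqrt (by linarith), Real.sq_sqrt hτ0.le]; ring) hA hB ?_
  · refine hadd.congr (fun k => ae_of_all _ fun z => ?_) (ae_of_all _ fun x => rfl)
    simp only [rankDiff, sum_leftIndex, sum_rightIndex, card_leftIndex, card_rightIndex,
      ← Finset.mul_sum]
    -- the identity also holds for empty samples, where all terms vanish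
    rcases Nat.eq_zero_or_pos (m k) with hm0 | hm0
    · simp [hm0]
    rcases Nat.eq_zero_or_pos (n k) with hn0 | hn0
    · have : (m k : ℝ) ≠ 0 := by positivity
      simp [hn0, this]
    generalize ∑ i ∈ Finset.range (m k), centredRank D F (z (Sum.inl i)) = S
    generalize ∑ i ∈ Finset.range (n k), centredRank D F (z (Sum.inr i)) = T
    have hmk : (0 : ℝ) < m k := by exact_mod_cast hm0
    have hnk : (0 : ℝ) < n k := by exact_mod_cast hn0
    generalize (m k : ℝ) = x at hmk ⊢
    generalize (n k : ℝ) = y at hnk ⊢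
    have hx : √x * √x = x := Real.mul_self_sqrt hmk.le
    have hy : √y * √y = y := Real.mul_self_sqrt hnk.le
    have hx0 : √x ≠ 0 := (Real.sqrt_pos.2 hmk).ne'
    have hy0 : √y ≠ 0 := (Real.sqrt_pos.2 hnk).ne'
    have hxy0 : √(x + y) ≠ 0 := (Real.sqrt_pos.2 (by linarith)).ne'
    have e1 : 1 - x / (x + y) = y / (x + y) := by field_simp; ring
    rw [e1, Real.sqrt_div hmk.le, Real.sqrt_div hnk.le, Real.sqrt_div (by positivity),
      Real.sqrt_mul (by positivity), Real.sqrt_mul (by positivity)]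
    have e2 : x⁻¹ = (√x)⁻¹ * (√x)⁻¹ := by rw [← mul_inv, hx]
    have e3 : y⁻¹ = (√y)⁻¹ * (√y)⁻¹ := by rw [← mul_inv, hy]
    rw [e2, e3]
    field_simp
    ring
  · intro k
    have hi : iIndepFun (fun (a : ℕ ⊕ ℕ) (z : ℕ ⊕ ℕ → E) => z a) (iidMeasure F (ℕ ⊕ ℕ)) :=
      iIndepFun_infinitePi (P := fun _ : ℕ ⊕ ℕ => F) (X := fun _ x => x) fun _ => measurable_id
    have hst := hi.indepFun_finset (leftIndex (m k)) (rightIndex (n k))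
      (disjoint_leftIndex_rightIndex _ _) fun a => measurable_pi_apply a
    have mr : Measurable fun x => √12 * centredRank D F x := (measurable_centredRank h).const_mul _
    have hφ : ∀ (u : Finset (ℕ ⊕ ℕ)) (c d : ℝ), Measurable fun x : u → E =>
        c * (d * ∑ a, √12 * centredRank D F (x a)) := fun u c d =>
      ((Finset.measurable_fun_sum _ fun a _ => mr.comp (measurable_pi_apply a)).const_mul _).const_mul _
    convert! hst.comp (hφ _ (-√(1 - (m k : ℝ) / ((m k : ℝ) + (n k : ℝ)))) (√(m k))⁻¹)
      (hφ _ (√((m k : ℝ) / ((m k : ℝ) + (n k : ℝ)))) (√(n k))⁻¹) using 1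
    · funext z
      simp only [Function.comp_apply]
      rw [Finset.sum_coe_sort (leftIndex (m k)) fun a => √12 * centredRank D F (z a), sum_leftIndex]
    · funext z
      simp only [Function.comp_apply]
      rw [Finset.sum_coe_sort (rightIndex (n k)) fun a => √12 * centredRank D F (z a),
        sum_rightIndex]

/-- The error of the linearization is negligible at the scale of the central limit theorem. -/
theorem tendstoInMeasure_qualityIndex_sub_rankDiff [MeasurableSingletonClass E] {ι : Type*}
    (h : RegularDepth D F β) {s t : ℕ → Finset ι} (hst : ∀ k, Disjoint (s k) (t k))
    (hs : Tendsto (fun k => (s k).card) atTop atTop)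
    (ht : Tendsto (fun k => (t k).card) atTop atTop) :
    TendstoInMeasure (iidMeasure F ι) (fun k z =>
      √(12 * (s k).card * (t k).card / ((s k).card + (t k).card)) *
        (qualityIndex D (empOn z (s k)) (empOn z (t k)) - 1 / 2 - rankDiff D F (s k) (t k) z))
      atTop (fun _ => 0) := by
  classical
  obtain ⟨b, N, hb, hbd⟩ := exists_bound_qualityIndex_sub_rankDiff (ι := ι) h
  rw [tendstoInMeasure_iff_measureReal_norm]
  intro ε hε
  have hlim : Tendsto (fun k => √12 * b (s k).card / ε) atTop (𝓝 0) := by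
    simpa using ((hb.comp hs).const_mul (√12)).div_const ε
  refine tendsto_of_tendsto_of_tendsto_of_le_of_le' tendsto_const_nhds hlim
    (Eventually.of_forall fun k => measureReal_nonneg) ?_
  filter_upwards [hs.eventually_ge_atTop N, ht.eventually_ge_atTop 1] with k hk1 hk2
  obtain ⟨hint, hle⟩ := hbd (s k) (t k) (hst k) hk1 (Finset.card_pos.1 hk2)
  rw [le_div_iff₀ hε, mul_comm]
  simp only [sub_zero]
  refine (mul_meas_ge_le_integral_of_nonneg (ae_of_all _ fun z => norm_nonneg _)
    (hint.const_mul _).norm ε).trans ?_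
  simp only [norm_mul, Real.norm_eq_abs, abs_of_nonneg (Real.sqrt_nonneg _)]
  rw [integral_const_mul, mul_assoc 12, mul_div_assoc, Real.sqrt_mul (by norm_num), mul_assoc]
  gcongr

/-- Since the two quality indices linearize to opposite linear parts, the quadratic form is
asymptotically its value at `(1, -1)` times the square of a standard normal variable. -/
theorem tendstoInDistribution_quadraticForm [MeasurableSingletonClass E]
    (h : RegularDepth D F β) {m n : ℕ → ℕ}
    (hm : Tendsto m atTop atTop) (hn : Tendsto n atTop atTop) {τ : ℝ} (hτ0 : 0 < τ) (hτ1 : τ < 1)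
    (hτ : Tendsto (fun k => (m k : ℝ) / ((m k : ℝ) + (n k : ℝ))) atTop (𝓝 τ))
    (M : Matrix (Fin 2) (Fin 2) ℝ) :
    TendstoInDistribution
      (fun (k : ℕ) (z : ℕ ⊕ ℕ → E) => 12 * (m k : ℝ) * (n k : ℝ) / ((m k : ℝ) + (n k : ℝ)) *
        (centredQuality D (empOn z (leftIndex (m k))) (empOn z (rightIndex (n k))) ⬝ᵥ
          (M *ᵥ centredQuality D (empOn z (leftIndex (m k))) (empOn z (rightIndex (n k))))))
      atTop (fun x => (M 0 0 - M 0 1 - M 1 0 + M 1 1) * x ^ 2)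
      (fun _ => iidMeasure F (ℕ ⊕ ℕ)) (gaussianReal 0 1) := by
  set c : ℕ → ℝ := fun k => 12 * (m k : ℝ) * (n k : ℝ) / ((m k : ℝ) + (n k : ℝ)) with hc
  have hc0 : ∀ k, 0 ≤ c k := fun k => by positivity
  let W : ℕ → (ℕ ⊕ ℕ → E) → ℝ := fun k z =>
    √(c k) * rankDiff D F (leftIndex (m k)) (rightIndex (n k)) z
  let e₁ : ℕ → (ℕ ⊕ ℕ → E) → ℝ := fun k z => √(c k) *
    (qualityIndex D (empOn z (leftIndex (m k))) (empOn z (rightIndex (n k))) - 1 / 2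
      - rankDiff D F (leftIndex (m k)) (rightIndex (n k)) z)
  let e₂ : ℕ → (ℕ ⊕ ℕ → E) → ℝ := fun k z => √(c k) *
    (qualityIndex D (empOn z (rightIndex (n k))) (empOn z (leftIndex (m k))) - 1 / 2
      - rankDiff D F (rightIndex (n k)) (leftIndex (m k)) z)
  have hcm : Tendsto (fun k => (leftIndex (m k)).card) atTop atTop := by
    simpa only [card_leftIndex] using hm
  have hcn : Tendsto (fun k => (rightIndex (n k)).card) atTop atTop := by
    simpa only [card_rightIndex] using hn
  have hW : TendstoInDistribution W atTop (fun x => x) (fun _ => iidMeasure F (ℕ ⊕ ℕ))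
    (gaussianReal 0 1) := tendstoInDistribution_rankDiff h hm hn hτ0 hτ1 hτ
  have he₁ : TendstoInMeasure (iidMeasure F (ℕ ⊕ ℕ)) e₁ atTop fun _ => 0 := by
    have := tendstoInMeasure_qualityIndex_sub_rankDiff h
      (fun k => disjoint_leftIndex_rightIndex (m k) (n k)) hcm hcn
    simpa only [card_leftIndex, card_rightIndex] using this
  have he₂ : TendstoInMeasure (iidMeasure F (ℕ ⊕ ℕ)) e₂ atTop fun _ => 0 := by
    have := tendstoInMeasure_qualityIndex_sub_rankDiff h
      (fun k => (disjoint_leftIndex_rightIndex (m k) (n k)).symm) hcn hcm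
    simp only [card_leftIndex, card_rightIndex] at this
    have hc' : ∀ k, c k = 12 * (n k : ℝ) * (m k : ℝ) / ((n k : ℝ) + (m k : ℝ)) := fun k => by
      rw [hc, mul_right_comm, add_comm]
    simpa only [e₂, hc'] using this
  have me₁ : ∀ k, Measurable (e₁ k) := fun k =>
    (((measurable_qualityIndex_empOn h _ _).sub_const _).sub (measurable_rankDiff h _ _)).const_mul _
  have me₂ : ∀ k, Measurable (e₂ k) := fun k =>
    (((measurable_qualityIndex_empOn h _ _).sub_const _).sub (measurable_rankDiff h _ _)).const_mul _
  have h1 := hW.prodMk_of_tendstoInMeasure_const W e₁ _ he₁ fun k => (me₁ k).aemeasurable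
  have h2 := h1.continuous_comp_prodMk_of_tendstoInMeasure_const
    (g := fun p : (ℝ × ℝ) × ℝ => M 0 0 * (p.1.1 + p.1.2) ^ 2
      + (M 0 1 + M 1 0) * ((p.1.1 + p.1.2) * (-p.1.1 + p.2)) + M 1 1 * (-p.1.1 + p.2) ^ 2)
    (by fun_prop) he₂ fun k => (me₂ k).aemeasurable
  refine h2.congr (fun k => ae_of_all _ fun z => ?_) (ae_of_all _ fun x => ?_)
  · simp only [W, e₁, e₂, centredQuality, Matrix.mulVec, dotProduct, Fin.sum_univ_two,
      Matrix.cons_val_zero, Matrix.cons_val_one, rankDiff_swap (leftIndex (m k))]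
    generalize qualityIndex D (empOn z (leftIndex (m k))) (empOn z (rightIndex (n k))) = q₁
    generalize qualityIndex D (empOn z (rightIndex (n k))) (empOn z (leftIndex (m k))) = q₂
    generalize rankDiff D F (leftIndex (m k)) (rightIndex (n k)) z = r
    have hk := Real.sq_sqrt (hc0 k)
    change _ = c k * _
    generalize √(c k) = a at hk ⊢
    rw [← hk]
    ring
  · simp only
    ring

end TwoSample

/-! ### The limit theorem -/

theorem theorem1 {d : ℕ} {Ω : Type*} [MeasurableSpace Ω] (P : Measure Ω) [IsProbabilityMeasure P]
    (F G : Measure (EuclideanSpace ℝ (Fin d))) [IsProbabilityMeasure F] [IsProbabilityMeasure G]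
    -- the depth function, with values in `[0, 1]`, and its measurability
    (D : EuclideanSpace ℝ (Fin d) → Measure (EuclideanSpace ℝ (Fin d)) → ℝ)
    (hD : ∀ (x : EuclideanSpace ℝ (Fin d)) (H : Measure (EuclideanSpace ℝ (Fin d)))
      [IsProbabilityMeasure H], 0 ≤ D x H ∧ D x H ≤ 1)
    (hD_meas : Measurable fun x => D x F)
    (hD_meas_emp : ∀ k : ℕ, Measurable fun p :
      EuclideanSpace ℝ (Fin d) × (Fin (k + 1) → EuclideanSpace ℝ (Fin d)) =>
        D p.1 (empiricalMeasure p.2))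
    -- the two independent i.i.d. samples
    (X Y : ℕ → Ω → EuclideanSpace ℝ (Fin d))
    (hX : ∀ i, HasLaw (X i) F P) (hY : ∀ j, HasLaw (Y j) G P)
    (hXY : iIndepFun (Sum.elim X Y) P)
    -- conditions A1 to A4
    (β : ℝ) (hβ : 1 / 2 < β) (hβ1 : β ≤ 1)
    (hA1 : CondA1 D F β) (hA2 : CondA2 D F β) (hA3 : CondA3 D F) (hA4 : CondA4 D F β)
    -- the sample sizes
    (m n : ℕ → ℕ) (hm : Tendsto m atTop atTop) (hn : Tendsto n atTop atTop)
    (τ : ℝ) (hτ0 : 0 < τ) (hτ1 : τ < 1)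
    (hτ : Tendsto (fun k => (m k : ℝ) / ((m k : ℝ) + (n k : ℝ))) atTop (𝓝 τ))
    -- the null hypothesis and the shape parameter
    (H0 : F = G) (lam : ℝ) (hlam : 0 < lam) :
    (∀ θ : ℝ, TendstoInDistribution
      (fun (k : ℕ) (ω : Ω) => ellipseStatistic D lam θ
        (fun i : Fin (m k) => X i ω) (fun j : Fin (n k) => Y j ω))
      atTop
      (fun z : ℝ => (1 + lam - (1 - lam) * Real.sin (2 * θ)) * z)
      (fun _ => P) chiSquaredOne) ∧
    TendstoInDistribution
      (fun (k : ℕ) (ω : Ω) => ellipseStatisticE D lam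
        (fun i : Fin (m k) => X i ω) (fun j : Fin (n k) => Y j ω) / (2 * lam))
      atTop (fun z : ℝ => z) (fun _ => P) chiSquaredOne := by
  subst H0
  have hreg : RegularDepth D F β := ⟨hβ, hD, hD_meas, hD_meas_emp, hA1, hA2, hA3, hA4⟩
  have hlaw : ∀ a, HasLaw (Sum.elim X Y a) F P := by
    rintro (i | j)
    · exact hX i
    · exact hY j
  have hZ : HasLaw (fun ω a => Sum.elim X Y a ω) (iidMeasure F (ℕ ⊕ ℕ)) P :=
    hXY.hasLaw_infinitePi hlaw (aemeasurable_pi_iff.2 fun a => (hlaw a).aemeasurable)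
  have main : ∀ θ : ℝ, TendstoInDistribution
      (fun (k : ℕ) (ω : Ω) => ellipseStatistic D lam θ
        (fun i : Fin (m k) => X i ω) (fun j : Fin (n k) => Y j ω))
      atTop (fun z : ℝ => (1 + lam - (1 - lam) * Real.sin (2 * θ)) * z)
      (fun _ => P) chiSquaredOne := by
    intro θ
    have h1 := (tendstoInDistribution_quadraticForm hreg hm hn hτ0 hτ1 hτ
      (ellipseMatrix lam θ)).comp_hasLaw hZ
    simp only [leftIndex, rightIndex, empOn_map] at h1
    refine TendstoInDistribution.of_map_eq h1 (by fun_prop) ?_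
    rw [chiSquaredOne, Measure.map_map (by fun_prop) (by fun_prop)]
    congr 1
    funext x
    simp only [ellipseMatrix, Function.comp_apply, Matrix.of_apply, Matrix.cons_val_zero,
      Matrix.cons_val_one, Matrix.cons_val', Matrix.cons_val_fin_one]
    rw [Real.sin_two_mul]
    linear_combination (1 + lam) * x ^ 2 * Real.sin_sq_add_cos_sq θ
  refine ⟨main, ?_⟩
  have h2 := (main (Real.pi / 4)).continuous_comp (g := fun x : ℝ => x / (2 * lam)) (by fun_prop)
  refine h2.congr (fun k => ae_of_all _ fun ω => rfl) (ae_of_all _ fun z => ?_)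
  simp only [Function.comp_apply]
  rw [show 2 * (Real.pi / 4) = Real.pi / 2 by ring, Real.sin_pi_div_two]
  field_simp
  ring
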